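/- **Definitions.** The *view* at distance $r$ of a node $v$ in a vertex-labelled graph consists of all nodes at distance at most $r$ from $v$ and all edges with an endpoint at distance at most $r-1$ from $v$, with $v$ marked as the center. A *local checker at distance $r$* decides at each node, from the isomorphism class of its view at distance $r$, whether to accept; a labelled graph is accepted if all its nodes accept. A *generalized-LCL on $c$-colored trees, checkable at distance $r$*, is given by a finite set of outputs and a local checker at distance $r$ which sees input colors and outputs; an output configuration is correct if it is accepted, and the instances of the problem are the finite $c$-colored trees (vertex colors in $\{1,\dots,c\}$, not necessarily proper) that have a correct output configuration. Its *complexity* at $n$ is the least $T$ such that some deterministic algorithm, which knows $n$, computes a correct output configuration on every $n$-vertex instance when each node decides from its view at distance $T$; nodes carry distinct identifiers from $\{1,\dots,n^{\kappa}\}$, with $\kappa\ge 1$ a fixed integer. For $c\ge 1$, let $S_{c,1}(n)=c^2/9$, $S_{c,2}(n)=(cn^c)^{2/(2c+1)}$, $S_{c,3}(n)=36n/\log^2 n$, and $S_{c,d}(n)=4n/g_d(\log n)$ for $d>3$, where $g_d$ is the inverse (near infinity) of $x\mapsto x/\log^{(d-3)}x$, the logarithm being iterated $d-3$ times. **Corollary.**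 Let $c,d\ge 1$ be integers. For every function $f:\mathbb N\to\mathbb N$ with $f(n)=O(S_{c,d}(n))$ there is a generalized-LCL on $c$-colored trees, checkable at distance $d+4$, whose complexity in the LOCAL model is $\Theta(f(n))$, for every choice of $\kappa\ge 1$. Moreover, the trees that are instances of this problem are exactly the $c$-colored trees accepted by some local checker at distance $d+4$. -/

import Mathlib

open Filter Asymptotics

/-! Views, local algorithms, local checkers -/

/-- A vertex-labelled graph with a marked vertex (the center). -/
structure View (Λ : Type) where
  /-- the vertices -/
  V : Type
  /-- the edges -/
  graph : SimpleGraph V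
  /-- the labels of the vertices -/
  label : V → Λ
  /-- the marked vertex -/
  center : V

/-- Isomorphism of views: a graph isomorphism that respects labels and centers. -/
def View.Iso {Λ : Type} (A B : View Λ) : Prop :=
  ∃ e : A.graph ≃g B.graph, (∀ v, B.label (e v) = A.label v) ∧ e A.center = B.center

/-- The view at distance `r` of the node `v`: all nodes at distance at most `r` from `v`, and all
edges with at least one endpoint at distance at most `r - 1` from `v`, with `v` as the center. -/
def viewAt {Λ V : Type} (r : ℕ) (G : SimpleGraph V) (lab : V → Λ) (v : V) : View Λ where
  V := {w : V // G.edist v w ≤ r}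
  graph :=
    { Adj := fun a b => G.Adj a b ∧ (G.edist v a < r ∨ G.edist v b < r)
      symm := ⟨fun _ _ h => ⟨h.1.symm, h.2.symm⟩⟩
      loopless := ⟨fun _ h => h.1.ne rfl⟩ }
  label := fun w => lab w
  center := ⟨v, by simp⟩

/-- A local algorithm with radius `r` (equivalently, with `r` communication rounds): the output of
a node is a function of the isomorphism class of its view at distance `r`. -/
structure LocalAlgorithm (Λ O : Type) (r : ℕ) where
  /-- the output at the center of a view -/
  run : View Λ → O
  /-- isomorphic views give the same output -/
  run_eq_of_iso : ∀ A B : View Λ, A.Iso B → run A = run B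

/-- The output of a local algorithm at the node `v` of a labelled graph. -/
def LocalAlgorithm.output {Λ O V : Type} {r : ℕ} (A : LocalAlgorithm Λ O r)
    (G : SimpleGraph V) (lab : V → Λ) (v : V) : O :=
  A.run (viewAt r G lab v)

/-- A local checker at distance `r`: a local algorithm whose output is accept or reject. -/
abbrev LocalChecker (Λ : Type) (r : ℕ) : Type 1 := LocalAlgorithm Λ Prop r

/-- A labelled graph is accepted by a local checker if every node accepts. -/
def LocalChecker.Accepts {Λ V : Type} {r : ℕ} (L : LocalChecker Λ r)
    (G : SimpleGraph V) (lab : V → Λ) : Prop :=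
  ∀ v : V, LocalAlgorithm.output L G lab v

/-! Generalized LCLs and their complexity in the LOCAL model -/

/-- A generalized LCL on `c`-colored trees, checkable at distance `r`: a finite set of outputs and
a local checker at distance `r` which sees, at every node, the input color and the output. -/
structure GeneralizedLCL (c r : ℕ) where
  /-- the outputs -/
  Out : Type
  /-- there are finitely many outputs -/
  finite_out : Finite Out
  /-- the checker that recognizes the correct output configurations -/
  checker : LocalChecker (Fin c × Out) r

/-- `out` is a correct output configuration on the graph `G` with input colors `col`. -/
def GeneralizedLCL.IsSolution {c r : ℕ} (P : GeneralizedLCL c r) {V : Type}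
    (G : SimpleGraph V) (col : V → Fin c) (out : V → P.Out) : Prop :=
  LocalChecker.Accepts P.checker G fun v => (col v, out v)

/-- The instances of the problem: the colored trees that have a correct output configuration. -/
def GeneralizedLCL.IsInstance {c r : ℕ} (P : GeneralizedLCL c r) {V : Type}
    (G : SimpleGraph V) (col : V → Fin c) : Prop :=
  G.IsTree ∧ ∃ out : V → P.Out, P.IsSolution G col out

/-- Some deterministic LOCAL algorithm solves `P` in `T` rounds on all `n`-vertex instances. Nodes
know `n` (the algorithm may depend on it), have distinct identifiers in `{1, …, n ^ κ}`, and decide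
from their view at distance `T`, which shows input colors and identifiers. -/
def GeneralizedLCL.SolvableInRounds {c r : ℕ} (P : GeneralizedLCL c r) (κ n T : ℕ) : Prop :=
  ∃ A : LocalAlgorithm (Fin c × ℕ) P.Out T,
    ∀ (V : Type) [Fintype V] (G : SimpleGraph V) (col : V → Fin c) (ident : V → ℕ),
      Fintype.card V = n → P.IsInstance G col →
      Function.Injective ident → (∀ v, 1 ≤ ident v ∧ ident v ≤ n ^ κ) →
      P.IsSolution G col (A.output G fun v => (col v, ident v))

/-- `t n` is the complexity of `P` on `n`-vertex instances, that is the least number of rounds in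
which it can be solved, for every `n`; identifiers are in `{1, …, n ^ κ}`. -/
def GeneralizedLCL.HasComplexity {c r : ℕ} (P : GeneralizedLCL c r) (κ : ℕ) (t : ℕ → ℕ) : Prop :=
  ∀ n : ℕ, IsLeast {T : ℕ | P.SolvableInRounds κ n T} (t n)

/-! The threshold function -/

/-- The function `x ↦ x / log^(m) x`, where the logarithm is iterated `m` times. -/
noncomputable def divIterLog (m : ℕ) (x : ℝ) : ℝ := x / (Real.log^[m] x)

/-- The inverse `g_d` of `x ↦ x / log^(d-3) x` (for `d > 3`). As that function is increasing only
from some point on, the largest preimage is taken. -/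
noncomputable def invDivIterLog (d : ℕ) (y : ℝ) : ℝ := sSup {x : ℝ | divIterLog (d - 3) x = y}

/-- The threshold function `S_{c,d}(n)`, for `d ≥ 1` (its value for `d = 0` is irrelevant). -/
noncomputable def threshold (c d n : ℕ) : ℝ :=
  match d with
  | 0 => 0
  | 1 => (c : ℝ) ^ 2 / 9
  | 2 => ((c : ℝ) * (n : ℝ) ^ c) ^ ((2 : ℝ) / (2 * (c : ℝ) + 1))
  | 3 => 36 * (n : ℝ) / Real.log n ^ 2
  | d + 4 => 4 * (n : ℝ) / invDivIterLog (d + 4) (Real.log n)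

/-! The problem hides one bit at the far end of a long path and asks every node to output it. An
instance is a caterpillar: a spine with positions `l + 2, ..., 1, 0`, where each node carries some
leaves and the root of a tree that encodes its position. The bit is the choice between the leaf
counts `2, 1` and `1, 2` at positions `0, 1`, so both bits give trees of the same size. Input colors
play no role.

Positions make these trees locally checkable. In a finite graph whose nodes all accept, a spine node
of largest position can only be a start, and the descending positions below it force the whole tree
(`exists_realizes_of_good`, `nonempty_iso_of_realizes`); conversely the trees are accepted
(`good_treeGraph`). The start sees its position and its number of leaves, which determine the number
`n` of nodes. Hence the checker may prescribe the spine length as a function `ell n`, through the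
relation `R`, while extra leaves at the start pad the tree to size `n`.

The diameter is linear in `l + d`, so that radius suffices to find the bit (`hiddenBit_solvable`).
The view of the start at radius at most `l + 1` does not depend on the bit, so a smaller radius
fails (`le_of_hiddenBit_solvable`).

It remains to make the codes small without making them deep. A code of level `e + 1` writes `i` with
`k` digits in base `k`, for the least `k ≥ 1` with `i < k ^ k`, and stores the digit `a` of index
`j` as the number `j * k + a < k ^ 2` in a code of level `e`. Since `k log k = O(log i)`, level `d ≥
2` needs only `O(log i * log^(d-1) i)` nodes (`isBigO_codeBound`), at depth `d + 1`. The threshold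
is such that a spine of length `f n / C` with these codes fits into `n` nodes for large `n`
(`isBigO_threshold_mul_codeBound`, `exists_eventually_codeBound_le`). Sizes with `f n = 0`, and the
finitely many sizes that are too small, get no instances. -/

namespace Caterpillar

/-! ### Node types and their realizations -/

theorem exists_lt_succ_pow_succ (i : ℕ) : ∃ k : ℕ, i < (k + 1) ^ (k + 1) :=
  ⟨i, (Nat.lt_succ_self i).trans_le (Nat.le_self_pow (Nat.succ_ne_zero i) _)⟩

/-- The least `k ≥ 1` with `i < k ^ k`. -/
def selfBase (i : ℕ) : ℕ := Nat.find (exists_lt_succ_pow_succ i) + 1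

/-- The types of nodes: leaves, roots of a tree of level `e` that encodes the number `i`, and nodes
of the spine at position `i` with `m` adjacent leaves, where `b` is the bit hidden at the end of
the spine. -/
inductive NodeType
  | leaf : NodeType
  | code (e i : ℕ) : NodeType
  | spine (b : Bool) (i m : ℕ) : NodeType

/-- The number of leaves at position `i` of the spine, unless it is the start of the spine. -/
def leafCount (b : Bool) : ℕ → ℕ
  | 0 => cond b 2 1
  | 1 => cond b 1 2
  | _ + 2 => 1

/-- The number of children of a node. -/
def arity : NodeType → ℕ
  | .leaf => 0
  | .code 0 i => i + 1
  | .code (_ + 1) i => selfBase i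
  | .spine _ 0 m => m + 1
  | .spine _ (_ + 1) m => m + 2

/-- The type of the `j`-th child of a node. -/
def child (d : ℕ) : NodeType → ℕ → NodeType
  | .leaf, _ => .leaf
  | .code 0 _, _ => .leaf
  | .code (e + 1) i, j => .code e (j * selfBase i + i / selfBase i ^ j % selfBase i)
  | .spine _ i _, 0 => .code d i
  | .spine _ 0 _, _ + 1 => .leaf
  | .spine b (i + 1) _, 1 => .spine b i (leafCount b i)
  | .spine _ (_ + 1) _, _ + 2 => .leaf

variable {V A B : Type}

/-- The branch of `G` at `v` that does not contain the neighbor `p` of `v` unfolds the type `τ`.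
For `p = v`, this branch is all of the graph. -/
inductive Realizes (d : ℕ) (G : SimpleGraph V) : V → V → NodeType → Prop
  | intro (p v : V) (τ : NodeType) (w : Fin (arity τ) → V) (hw : Function.Injective w)
      (hadj : ∀ x, (G.Adj v x ∧ x ≠ p) ↔ ∃ j, w j = x)
      (h : ∀ j : Fin (arity τ), Realizes d G v (w j) (child d τ j)) : Realizes d G p v τ

theorem realizes_iff {d : ℕ} {G : SimpleGraph V} {p v : V} {τ : NodeType} :
    Realizes d G p v τ ↔ ∃ w : Fin (arity τ) → V, Function.Injective w ∧
      (∀ x, (G.Adj v x ∧ x ≠ p) ↔ ∃ j, w j = x) ∧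
      ∀ j : Fin (arity τ), Realizes d G v (w j) (child d τ j) := by
  constructor
  · rintro ⟨_, _, _, w, hw, hadj, h⟩
    exact ⟨w, hw, hadj, h⟩
  · rintro ⟨w, hw, hadj, h⟩
    exact ⟨_, _, _, w, hw, hadj, h⟩

/-! ### The conditions that the checker verifies -/

/-- The node `v` has exactly one neighbor. -/
def IsLeaf (G : SimpleGraph V) (v : V) : Prop :=
  ∃ p, G.Adj v p ∧ ∀ x, G.Adj v x → x = p

/-- The node `v` has a leaf and two other nodes among its neighbors. -/
def Spinelike (G : SimpleGraph V) (v : V) : Prop :=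
  (∃ w, G.Adj v w ∧ IsLeaf G w) ∧
    ∃ w, G.Adj v w ∧ ∃ w', G.Adj v w' ∧ w ≠ w' ∧ ¬IsLeaf G w ∧ ¬IsLeaf G w'

/-- The neighbors of `v` are `m` leaves, the root of a tree that encodes `i`, and nodes that look
like nodes of the spine. -/
def HasBag (d : ℕ) (G : SimpleGraph V) (v : V) (i m : ℕ) : Prop :=
  (∃ c, G.Adj v c ∧ Realizes d G v c (.code d i) ∧
    ∀ x, G.Adj v x → x = c ∨ IsLeaf G x ∨ Spinelike G x) ∧
  {x | G.Adj v x ∧ IsLeaf G x}.ncard = m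

/-- The node `v` is consistent with its neighbors on the spine. The relation `R` says which
positions and numbers of leaves are allowed at the start of the spine. -/
def SpineConsistent (d : ℕ) (R : ℕ → ℕ → Prop) (G : SimpleGraph V) (v : V) : Prop :=
  (∃ b, HasBag d G v 0 (leafCount b 0) ∧ ∃ u, G.Adj v u ∧ Spinelike G u ∧
    (∀ x, G.Adj v x → Spinelike G x → x = u) ∧ HasBag d G u 1 (leafCount b 1)) ∨
  (∃ i m, HasBag d G v (i + 2) m ∧ R (i + 2) m ∧ ∃ u, G.Adj v u ∧ Spinelike G u ∧
    (∀ x, G.Adj v x → Spinelike G x → x = u) ∧ ∃ m', HasBag d G u (i + 1) m') ∨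
  (∃ i m, HasBag d G v (i + 1) m ∧ (1 ≤ i → m = 1) ∧ ∃ u, G.Adj v u ∧ Spinelike G u ∧
    (∃ m', HasBag d G u i m') ∧ ∃ u', G.Adj v u' ∧ Spinelike G u' ∧
    (∃ m', HasBag d G u' (i + 2) m') ∧ ∀ x, G.Adj v x → Spinelike G x → x = u ∨ x = u')

/-- There is a node at distance at most `k` from `v` that looks like a node of the spine. -/
def NearSpine (G : SimpleGraph V) : ℕ → V → Prop
  | 0, v => Spinelike G v
  | k + 1, v => NearSpine G k v ∨ ∃ w, G.Adj v w ∧ NearSpine G k w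

/-- The condition that the checker verifies at the node `v`. -/
def Good (d : ℕ) (R : ℕ → ℕ → Prop) (G : SimpleGraph V) (v : V) : Prop :=
  NearSpine G (d + 2) v ∧ (Spinelike G v → SpineConsistent d R G v)

/-- The node `v` is the end of a spine that hides the bit `b`. -/
def IsEnd (d : ℕ) (G : SimpleGraph V) (b : Bool) (v : V) : Prop :=
  Spinelike G v ∧ HasBag d G v 0 (leafCount b 0)

/-! ### Transfer along injective maps that are locally bijective near a node -/

/-- The map `f` maps the neighbors of `a` onto the neighbors of `f a`. -/
def NbhdOnto (H : SimpleGraph A) (G : SimpleGraph B) (f : A → B) (a : A) : Prop :=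
  ∀ b, G.Adj (f a) b ↔ ∃ a', H.Adj a a' ∧ f a' = b

/-- `NbhdOnto` at all nodes at distance at most `m` from `a`. -/
def NbhdOntoWithin (H : SimpleGraph A) (G : SimpleGraph B) (f : A → B) : ℕ → A → Prop
  | 0, a => NbhdOnto H G f a
  | m + 1, a => NbhdOnto H G f a ∧ ∀ a', H.Adj a a' → NbhdOntoWithin H G f m a'

section Transfer

variable {H : SimpleGraph A} {G : SimpleGraph B} {f : A → B}

theorem NbhdOntoWithin.nbhdOnto {m : ℕ} {a : A} (h : NbhdOntoWithin H G f m a) :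
    NbhdOnto H G f a := by
  cases m
  · exact h
  · exact h.1

theorem NbhdOntoWithin.of_succ {m : ℕ} {a : A} (h : NbhdOntoWithin H G f (m + 1) a) :
    NbhdOntoWithin H G f m a := by
  induction m generalizing a with
  | zero => exact h.1
  | succ m ih => exact ⟨h.1, fun a' ha' => ih (h.2 a' ha')⟩

theorem NbhdOntoWithin.mono {m n : ℕ} {a : A} (h : NbhdOntoWithin H G f n a) (hmn : m ≤ n) :
    NbhdOntoWithin H G f m a := by
  induction n, hmn using Nat.le_induction with
  | base => exact h
  | succ n _ ih => exact ih h.of_succ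

theorem nbhdOntoWithin_of_forall (h : ∀ a, NbhdOnto H G f a) (m : ℕ) (a : A) :
    NbhdOntoWithin H G f m a := by
  induction m generalizing a with
  | zero => exact h a
  | succ m ih => exact ⟨h a, fun a' _ => ih a'⟩

/-- All conditions of the checker are nested quantifiers over neighbors, so this and `forall_iff`
transfer them between a view and the graph, and along isomorphisms. -/
theorem NbhdOnto.exists_iff {a : A} (h : NbhdOnto H G f a) {P : A → Prop} {Q : B → Prop}
    (hPQ : ∀ x, H.Adj a x → (P x ↔ Q (f x))) :
    (∃ x, H.Adj a x ∧ P x) ↔ ∃ y, G.Adj (f a) y ∧ Q y := by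
  constructor
  · rintro ⟨x, hx, hP⟩
    exact ⟨f x, (h _).2 ⟨x, hx, rfl⟩, (hPQ x hx).1 hP⟩
  · rintro ⟨y, hy, hQ⟩
    obtain ⟨x, hx, rfl⟩ := (h _).1 hy
    exact ⟨x, hx, (hPQ x hx).2 hQ⟩

theorem NbhdOnto.forall_iff {a : A} (h : NbhdOnto H G f a) {P : A → Prop} {Q : B → Prop}
    (hPQ : ∀ x, H.Adj a x → (P x ↔ Q (f x))) :
    (∀ x, H.Adj a x → P x) ↔ ∀ y, G.Adj (f a) y → Q y := by
  constructor
  · intro hP y hy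
    obtain ⟨x, hx, rfl⟩ := (h _).1 hy
    exact (hPQ x hx).1 (hP x hx)
  · intro hQ x hx
    exact (hPQ x hx).2 (hQ _ ((h _).2 ⟨x, hx, rfl⟩))

theorem isLeaf_map_iff (hf : Function.Injective f) {a : A} (h : NbhdOntoWithin H G f 0 a) :
    IsLeaf H a ↔ IsLeaf G (f a) := by
  have h : NbhdOnto H G f a := h
  exact h.exists_iff fun _ _ => h.forall_iff fun _ _ => hf.eq_iff.symm

theorem spinelike_map_iff (hf : Function.Injective f) {a : A} (h : NbhdOntoWithin H G f 1 a) :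
    Spinelike H a ↔ Spinelike G (f a) := by
  have hl : ∀ x, H.Adj a x → (IsLeaf H x ↔ IsLeaf G (f x)) := fun x hx =>
    isLeaf_map_iff hf (h.2 x hx)
  refine and_congr (h.1.exists_iff hl) (h.1.exists_iff fun x hx => h.1.exists_iff fun y hy => ?_)
  rw [hl x hx, hl y hy, hf.ne_iff]

/-- Only injectivity of `f` is used at the excluded neighbor `p`; local surjectivity is needed at
`a` alone, to pull children back. -/
theorem realizes_map_iff_of_child {d : ℕ} (hf : Function.Injective f) {p a : A} {τ : NodeType}
    (h : NbhdOnto H G f a)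
    (hc : ∀ j < arity τ, ∀ x, H.Adj a x →
      (Realizes d H a x (child d τ j) ↔ Realizes d G (f a) (f x) (child d τ j))) :
    Realizes d H p a τ ↔ Realizes d G (f p) (f a) τ := by
  rw [realizes_iff, realizes_iff]
  constructor
  · rintro ⟨w, hw, hadj, hr⟩
    refine ⟨f ∘ w, hf.comp hw, fun y => ⟨?_, ?_⟩, fun j => ?_⟩
    · rintro ⟨hy, hyp⟩
      obtain ⟨x, hx, rfl⟩ := (h _).1 hy
      obtain ⟨j, rfl⟩ := (hadj x).1 ⟨hx, fun h => hyp (h ▸ rfl)⟩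
      exact ⟨j, rfl⟩
    · rintro ⟨j, rfl⟩
      have := (hadj (w j)).2 ⟨j, rfl⟩
      exact ⟨(h _).2 ⟨_, this.1, rfl⟩, hf.ne this.2⟩
    · exact (hc j j.2 _ ((hadj (w j)).2 ⟨j, rfl⟩).1).1 (hr j)
  · rintro ⟨w, hw, hadj, hr⟩
    have hex : ∀ j, ∃ x, H.Adj a x ∧ f x = w j := fun j =>
      (h _).1 ((hadj (w j)).2 ⟨j, rfl⟩).1
    choose w' hw' hfw' using hex
    refine ⟨w', fun i j hij => hw (by rw [← hfw', ← hfw', hij]), fun x => ⟨?_, ?_⟩, fun j => ?_⟩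
    · rintro ⟨hx, hxp⟩
      obtain ⟨j, hj⟩ := (hadj (f x)).1 ⟨(h _).2 ⟨x, hx, rfl⟩, hf.ne hxp⟩
      exact ⟨j, hf ((hfw' j).trans hj)⟩
    · rintro ⟨j, rfl⟩
      refine ⟨hw' j, fun hp => ((hadj (w j)).2 ⟨j, rfl⟩).2 ?_⟩
      rw [← hfw', hp]
    · exact (hc j j.2 _ (hw' j)).2 (by rw [hfw']; exact hr j)

theorem realizes_leaf_map_iff {d : ℕ} (hf : Function.Injective f) {p a : A}
    (h : NbhdOntoWithin H G f 0 a) :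
    Realizes d H p a .leaf ↔ Realizes d G (f p) (f a) .leaf :=
  realizes_map_iff_of_child hf h fun _ hj => absurd hj (Nat.not_lt_zero _)

theorem realizes_code_map_iff {d e i : ℕ} (hf : Function.Injective f) {p a : A}
    (h : NbhdOntoWithin H G f (e + 1) a) :
    Realizes d H p a (.code e i) ↔ Realizes d G (f p) (f a) (.code e i) := by
  induction e generalizing i p a with
  | zero => exact realizes_map_iff_of_child hf h.1 fun _ _ x hx =>
      realizes_leaf_map_iff hf (h.2 x hx)
  | succ e ih => exact realizes_map_iff_of_child hf h.1 fun _ _ x hx => ih (h.2 x hx)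

theorem hasBag_map_iff {d i m : ℕ} (hf : Function.Injective f) {a : A}
    (h : NbhdOntoWithin H G f (d + 2) a) : HasBag d H a i m ↔ HasBag d G (f a) i m := by
  have hl : ∀ x, H.Adj a x → (IsLeaf H x ↔ IsLeaf G (f x)) := fun x hx =>
    isLeaf_map_iff hf ((h.2 x hx).mono (Nat.zero_le _))
  have hs : ∀ x, H.Adj a x → (Spinelike H x ↔ Spinelike G (f x)) := fun x hx =>
    spinelike_map_iff hf ((h.2 x hx).mono (Nat.le_add_left _ _))
  have himage : {y | G.Adj (f a) y ∧ IsLeaf G y} = f '' {x | H.Adj a x ∧ IsLeaf H x} := by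
    ext y
    constructor
    · rintro ⟨hy, hly⟩
      obtain ⟨x, hx, rfl⟩ := (h.1 _).1 hy
      exact ⟨x, ⟨hx, (hl x hx).2 hly⟩, rfl⟩
    · rintro ⟨x, ⟨hx, hlx⟩, rfl⟩
      exact ⟨(h.1 _).2 ⟨x, hx, rfl⟩, (hl x hx).1 hlx⟩
  unfold HasBag
  rw [himage, Set.ncard_image_of_injective _ hf]
  refine and_congr_left fun _ => h.1.exists_iff fun x hx => and_congr
    (realizes_code_map_iff hf (h.2 x hx)) (h.1.forall_iff fun y hy => ?_)
  rw [hl y hy, hs y hy, hf.eq_iff]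

theorem spineConsistent_map_iff {d : ℕ} {R : ℕ → ℕ → Prop} (hf : Function.Injective f) {a : A}
    (h : NbhdOntoWithin H G f (d + 3) a) :
    SpineConsistent d R H a ↔ SpineConsistent d R G (f a) := by
  have hs : ∀ x, H.Adj a x → (Spinelike H x ↔ Spinelike G (f x)) := fun x hx =>
    spinelike_map_iff hf ((h.2 x hx).mono (Nat.le_add_left _ _))
  have hb : ∀ {i m x}, H.Adj a x → (HasBag d H x i m ↔ HasBag d G (f x) i m) := fun hx =>
    hasBag_map_iff hf (h.2 _ hx)
  have ha : ∀ {i m}, HasBag d H a i m ↔ HasBag d G (f a) i m := hasBag_map_iff hf h.of_succ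
  refine or_congr (exists_congr fun b => and_congr ha (h.1.exists_iff fun x hx => ?_))
    (or_congr (exists_congr fun i => exists_congr fun m => and_congr ha (and_congr_right fun _ =>
      h.1.exists_iff fun x hx => ?_)) (exists_congr fun i => exists_congr fun m =>
      and_congr ha (and_congr_right fun _ => h.1.exists_iff fun x hx => ?_)))
  · exact and_congr (hs x hx) (and_congr (h.1.forall_iff fun y hy => by
      rw [hs y hy, hf.eq_iff]) (hb hx))
  · exact and_congr (hs x hx) (and_congr (h.1.forall_iff fun y hy => by
      rw [hs y hy, hf.eq_iff]) (exists_congr fun _ => hb hx))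
  · exact and_congr (hs x hx) (and_congr (exists_congr fun _ => hb hx)
      (h.1.exists_iff fun y hy => and_congr (hs y hy) (and_congr (exists_congr fun _ => hb hy)
        (h.1.forall_iff fun z hz => by rw [hs z hz, hf.eq_iff, hf.eq_iff]))))

theorem nearSpine_map_iff {k : ℕ} (hf : Function.Injective f) {a : A}
    (h : NbhdOntoWithin H G f (k + 1) a) : NearSpine H k a ↔ NearSpine G k (f a) := by
  induction k generalizing a with
  | zero => exact spinelike_map_iff hf h
  | succ k ih => exact or_congr (ih h.of_succ) (h.1.exists_iff fun x hx => ih (h.2 x hx))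

/-- The radius `d + 3` is one step to a spine neighbor, one to the root of its code and `d + 1`
levels of code. A view must reach one step further, whence `d + 4`. -/
theorem good_map_iff {d : ℕ} {R : ℕ → ℕ → Prop} (hf : Function.Injective f) {a : A}
    (h : NbhdOntoWithin H G f (d + 3) a) : Good d R H a ↔ Good d R G (f a) :=
  and_congr (nearSpine_map_iff hf h) (imp_congr
    (spinelike_map_iff hf (h.mono (Nat.le_add_left _ _))) (spineConsistent_map_iff hf h))

theorem isEnd_map_iff {d : ℕ} {b : Bool} (hf : Function.Injective f) {a : A}
    (h : NbhdOntoWithin H G f (d + 2) a) : IsEnd d H b a ↔ IsEnd d G b (f a) :=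
  and_congr (spinelike_map_iff hf (h.mono (Nat.le_add_left _ _))) (hasBag_map_iff hf h)

theorem nbhdOnto_iso (e : H ≃g G) (a : A) : NbhdOnto H G e a := by
  intro b
  constructor
  · intro h
    exact ⟨e.symm b, by rwa [← e.map_adj_iff, RelIso.apply_symm_apply], e.apply_symm_apply b⟩
  · rintro ⟨a', ha', rfl⟩
    exact e.map_adj_iff.2 ha'

theorem nbhdOntoWithin_iso (e : H ≃g G) (m : ℕ) (a : A) : NbhdOntoWithin H G e m a :=
  nbhdOntoWithin_of_forall (nbhdOnto_iso e) m a

/-- A node at distance less than `r` from the center keeps all its neighbors and edges in the view,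
and each step away costs one unit of distance. -/
theorem nbhdOntoWithin_viewAt {Λ : Type} {G : SimpleGraph V} {lab : V → Λ} {r : ℕ} {v : V} (m : ℕ)
    (a : (viewAt r G lab v).V) (h : G.edist v a.1 + m < r) :
    NbhdOntoWithin (viewAt r G lab v).graph G Subtype.val m a := by
  have key : ∀ (a : (viewAt r G lab v).V), G.edist v a.1 < r →
      NbhdOnto (viewAt r G lab v).graph G Subtype.val a := by
    intro a ha b
    constructor
    · intro hb
      have h1 : G.edist v b ≤ G.edist v a.1 + 1 :=
        (SimpleGraph.edist_triangle).trans (by rw [SimpleGraph.edist_eq_one_iff_adj.2 hb])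
      exact ⟨⟨b, h1.trans (Order.add_one_le_of_lt ha)⟩, ⟨hb, Or.inl ha⟩, rfl⟩
    · rintro ⟨a', ha', rfl⟩
      exact ha'.1
  induction m generalizing a with
  | zero => exact key a (by simpa using h)
  | succ m ih =>
    refine ⟨key a (lt_of_le_of_lt le_self_add h), fun a' ha' => ih a' (lt_of_le_of_lt ?_ h)⟩
    have h1 : G.edist v a'.1 ≤ G.edist v a.1 + 1 :=
      (SimpleGraph.edist_triangle).trans (by rw [SimpleGraph.edist_eq_one_iff_adj.2 ha'.1])
    calc G.edist v a'.1 + (m : ℕ∞) ≤ G.edist v a.1 + 1 + m := by gcongr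
      _ = G.edist v a.1 + ((m + 1 : ℕ) : ℕ∞) := by push_cast; rw [add_assoc, add_comm 1 (m : ℕ∞)]

theorem nbhdOntoWithin_viewAt_center {Λ : Type} {G : SimpleGraph V} {lab : V → Λ} {r m : ℕ} {v : V}
    (h : m < r) : NbhdOntoWithin (viewAt r G lab v).graph G Subtype.val m
      (viewAt r G lab v).center :=
  nbhdOntoWithin_viewAt m _ (by
    change G.edist v v + (m : ℕ∞) < r
    rw [SimpleGraph.edist_self, zero_add]
    exact_mod_cast h)

end Transfer

/-! ### Numbers are determined by their codes -/

theorem lt_selfBase_pow (i : ℕ) : i < selfBase i ^ selfBase i :=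
  Nat.find_spec (exists_lt_succ_pow_succ i)

theorem selfBase_pos (i : ℕ) : 0 < selfBase i := Nat.succ_pos _

theorem arity_code_pos (e i : ℕ) : 0 < arity (.code e i) := by
  cases e
  · exact Nat.succ_pos i
  · exact selfBase_pos i

theorem eq_of_digits_eq {b m x y : ℕ} (hx : x < b ^ m) (hy : y < b ^ m)
    (h : ∀ j < m, x / b ^ j % b = y / b ^ j % b) : x = y := by
  induction m generalizing x y with
  | zero => simp at hx hy; omega
  | succ m ih =>
    have h0 := h 0 (Nat.succ_pos m)
    simp only [pow_zero, Nat.div_one] at h0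
    have h1 : x / b = y / b := by
      refine ih (Nat.div_lt_of_lt_mul (by rwa [← pow_succ']))
        (Nat.div_lt_of_lt_mul (by rwa [← pow_succ'])) fun j hj => ?_
      have := h (j + 1) (by omega)
      rwa [pow_succ', ← Nat.div_div_eq_div_mul, ← Nat.div_div_eq_div_mul] at this
    rw [← Nat.div_add_mod x b, ← Nat.div_add_mod y b, h0, h1]

theorem arity_eq_of_realizes {d : ℕ} {G : SimpleGraph V} {p v : V} {σ τ : NodeType}
    (hσ : Realizes d G p v σ) (hτ : Realizes d G p v τ) : arity σ = arity τ := by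
  obtain ⟨w, hw, hadj, -⟩ := realizes_iff.1 hσ
  obtain ⟨w', hw', hadj', -⟩ := realizes_iff.1 hτ
  have hr : Set.range w = Set.range w' := by
    ext x
    exact (hadj x).symm.trans (hadj' x)
  have := congrArg Set.ncard hr
  rwa [← Set.image_univ, ← Set.image_univ, Set.ncard_image_of_injective _ hw,
    Set.ncard_image_of_injective _ hw', Set.ncard_univ, Set.ncard_univ, Nat.card_fin,
    Nat.card_fin] at this

/-- The number of children reveals the base. Children are unordered, but each encodes index times
base plus digit; division by the base recovers the index, and the digits then determine the number.
-/
theorem code_injective {d e i i' : ℕ} {G : SimpleGraph V} {p v : V}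
    (h : Realizes d G p v (.code e i)) (h' : Realizes d G p v (.code e i')) : i = i' := by
  induction e generalizing i i' p v with
  | zero => exact Nat.succ_injective (arity_eq_of_realizes h h')
  | succ e ih =>
    have hk : selfBase i = selfBase i' := arity_eq_of_realizes h h'
    obtain ⟨w, hw, hadj, hr⟩ := realizes_iff.1 h
    obtain ⟨w', hw', hadj', hr'⟩ := realizes_iff.1 h'
    refine eq_of_digits_eq (lt_selfBase_pow i) (hk ▸ lt_selfBase_pow i') fun j hj => ?_
    obtain ⟨j', hj'⟩ := (hadj' _).1 ((hadj (w ⟨j, hj⟩)).2 ⟨_, rfl⟩)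
    have h2 := hr' j'
    rw [hj'] at h2
    have h3 := ih (hr ⟨j, hj⟩) h2
    simp only [← hk] at h3
    have hd : ∀ a, a % selfBase i < selfBase i := fun a => Nat.mod_lt _ (selfBase_pos i)
    have h4 : j = j' := by
      have := congrArg (· / selfBase i) h3
      simpa only [Nat.mul_comm _ (selfBase i), Nat.mul_add_div (selfBase_pos i),
        Nat.div_eq_of_lt (hd _), add_zero] using this
    rw [← h4] at h3
    exact Nat.add_left_cancel h3

/-! ### Leaves, nodes of the spine and roots of codes -/

theorem IsLeaf.eq_of_adj {G : SimpleGraph V} {v x y : V} (h : IsLeaf G v) (hx : G.Adj v x)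
    (hy : G.Adj v y) : x = y := by
  obtain ⟨p, -, hp⟩ := h
  rw [hp x hx, hp y hy]

theorem Spinelike.not_isLeaf {G : SimpleGraph V} {v : V} (h : Spinelike G v) : ¬IsLeaf G v := by
  obtain ⟨-, w, hw, w', hw', hne, -⟩ := h
  exact fun hl => hne (hl.eq_of_adj hw hw')

theorem not_isLeaf_of_realizes_code {d e i : ℕ} {G : SimpleGraph V} {v c : V} (hvc : G.Adj v c)
    (h : Realizes d G v c (.code e i)) : ¬IsLeaf G c := by
  obtain ⟨w, -, hadj, -⟩ := realizes_iff.1 h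
  have := (hadj (w ⟨0, arity_code_pos e i⟩)).2 ⟨_, rfl⟩
  exact fun hl => this.2 (hl.eq_of_adj this.1 hvc.symm)

theorem isLeaf_of_realizes_leaf {d : ℕ} {G : SimpleGraph V} {v c : V} (hvc : G.Adj v c)
    (h : Realizes d G v c .leaf) : IsLeaf G c := by
  obtain ⟨w, -, hadj, -⟩ := realizes_iff.1 h
  refine ⟨v, hvc.symm, fun x hx => ?_⟩
  by_contra hne
  obtain ⟨j, -⟩ := (hadj x).1 ⟨hx, hne⟩
  exact absurd j.2 (Nat.not_lt_zero _)

theorem IsLeaf.realizes {d : ℕ} {G : SimpleGraph V} {v c : V} (h : IsLeaf G c) (hvc : G.Adj v c) :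
    Realizes d G v c .leaf := by
  refine realizes_iff.2 ⟨fun j => absurd j.2 (Nat.not_lt_zero _), fun j =>
    absurd j.2 (Nat.not_lt_zero _), fun x => ⟨?_, ?_⟩, fun j => absurd j.2 (Nat.not_lt_zero _)⟩
  · rintro ⟨hx, hne⟩
    exact absurd (h.eq_of_adj hx hvc.symm) hne
  · rintro ⟨j, -⟩
    exact absurd j.2 (Nat.not_lt_zero _)

/-- At level `0` all neighbors other than `v` are leaves, so two inner neighbors are missing; at
higher levels no neighbor is a leaf. -/
theorem not_spinelike_of_realizes_code {d e i : ℕ} {G : SimpleGraph V} {v c : V}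
    (hv : ¬IsLeaf G v) (h : Realizes d G v c (.code e i)) : ¬Spinelike G c := by
  rintro ⟨⟨x, hx, hxl⟩, y, hy, z, hz, hne, hyl, hzl⟩
  obtain ⟨w, -, hadj, hr⟩ := realizes_iff.1 h
  cases e with
  | zero =>
    have key : ∀ y, G.Adj c y → ¬IsLeaf G y → y = v := by
      intro y hy hyl
      by_contra hyv
      obtain ⟨j, rfl⟩ := (hadj y).1 ⟨hy, hyv⟩
      exact hyl (isLeaf_of_realizes_leaf hy (hr j))
    exact hne ((key y hy hyl).trans (key z hz hzl).symm)
  | succ e =>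
    obtain ⟨j, rfl⟩ := (hadj x).1 ⟨hx, fun hxv => hv (hxv ▸ hxl)⟩
    exact not_isLeaf_of_realizes_code hx (hr j) hxl

/-- A root of a code is neither a leaf nor spinelike, so only one neighbor can play that part. Thus
a spine node has a well-defined position. -/
theorem HasBag.unique {d i m i' m' : ℕ} {G : SimpleGraph V} {v : V} (hv : Spinelike G v)
    (h : HasBag d G v i m) (h' : HasBag d G v i' m') : i = i' ∧ m = m' := by
  obtain ⟨⟨c, hc, hcr, hcx⟩, hm⟩ := h
  obtain ⟨⟨c', hc', hcr', -⟩, hm'⟩ := h'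
  refine ⟨?_, hm.symm.trans hm'⟩
  obtain rfl : c' = c := by
    rcases hcx c' hc' with h | h | h
    · exact h
    · exact absurd h (not_isLeaf_of_realizes_code hc' hcr')
    · exact absurd h (not_spinelike_of_realizes_code hv.not_isLeaf hcr')
  exact code_injective hcr hcr'

/-! ### From the local conditions to a realization -/

theorem exists_fin_enumeration {s : Set V} {m : ℕ} (hs : s.Finite) (hm : s.ncard = m) :
    ∃ w : Fin m → V, Function.Injective w ∧ Set.range w = s := by
  have := hs.to_subtype
  have e : Fin m ≃ s := (Finite.equivFinOfCardEq hm).symm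
  exact ⟨fun j => e j, Subtype.val_injective.comp e.injective, by
    rw [Set.range_comp' Subtype.val e, e.range_eq_univ, Set.image_univ, Subtype.range_coe]⟩

theorem realizes_spine_zero [Finite V] {d : ℕ} {G : SimpleGraph V} {p v : V} {b : Bool} {m : ℕ}
    (hv : Spinelike G v) (hp : p = v ∨ Spinelike G p)
    (hS : ∀ x, G.Adj v x → Spinelike G x → x = p) (h : HasBag d G v 0 m) :
    Realizes d G p v (.spine b 0 m) := by
  obtain ⟨⟨c, hc, hcr, hcx⟩, hm⟩ := h
  obtain ⟨w, hw, hwr⟩ := exists_fin_enumeration (Set.toFinite _) hm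
  have hwl : ∀ j, G.Adj v (w j) ∧ IsLeaf G (w j) := fun j => hwr.subset ⟨j, rfl⟩
  have hcl := not_isLeaf_of_realizes_code hc hcr
  have hcs := not_spinelike_of_realizes_code hv.not_isLeaf hcr
  have hne : ∀ x, G.Adj v x → ¬Spinelike G x → x ≠ p := by
    rintro x hx hxs rfl
    exact hp.elim (fun h => hx.ne h.symm) hxs
  refine realizes_iff.2 ⟨Fin.cons c w, Fin.cons_injective_iff.2 ⟨?_, hw⟩, fun x => ⟨?_, ?_⟩, ?_⟩
  · rintro ⟨j, rfl⟩
    exact hcl (hwl j).2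
  · rintro ⟨hx, hxp⟩
    rcases hcx x hx with rfl | h | h
    · exact ⟨(0 : Fin (m + 1)), rfl⟩
    · obtain ⟨j, rfl⟩ := hwr.superset ⟨hx, h⟩
      exact ⟨j.succ, Fin.cons_succ _ _ _⟩
    · exact absurd (hS x hx h) hxp
  · rintro ⟨j, rfl⟩
    induction j using Fin.cases with
    | zero => exact ⟨hc, hne c hc hcs⟩
    | succ j => exact ⟨(hwl j).1, hne _ (hwl j).1 fun h => h.not_isLeaf (hwl j).2⟩
  · intro j
    induction j using Fin.cases with
    | zero => exact hcr
    | succ j => exact (hwl j).2.realizes (hwl j).1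

theorem realizes_spine_succ [Finite V] {d i m m' : ℕ} {G : SimpleGraph V} {p v u : V} {b : Bool}
    (hv : Spinelike G v) (hp : p = v ∨ Spinelike G p) (hu : G.Adj v u) (hus : Spinelike G u)
    (hup : u ≠ p) (hS : ∀ x, G.Adj v x → Spinelike G x → x = u ∨ x = p)
    (h : HasBag d G v (i + 1) m) (hru : Realizes d G v u (.spine b i m'))
    (hm' : m' = leafCount b i) :
    Realizes d G p v (.spine b (i + 1) m) := by
  subst hm'
  obtain ⟨⟨c, hc, hcr, hcx⟩, hm⟩ := h
  obtain ⟨w, hw, hwr⟩ := exists_fin_enumeration (Set.toFinite _) hm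
  have hwl : ∀ j, G.Adj v (w j) ∧ IsLeaf G (w j) := fun j => hwr.subset ⟨j, rfl⟩
  have hcl := not_isLeaf_of_realizes_code hc hcr
  have hcs := not_spinelike_of_realizes_code hv.not_isLeaf hcr
  have hne : ∀ x, G.Adj v x → ¬Spinelike G x → x ≠ p := by
    rintro x hx hxs rfl
    exact hp.elim (fun h => hx.ne h.symm) hxs
  refine realizes_iff.2 ⟨Fin.cons c (Fin.cons u w), Fin.cons_injective_iff.2 ⟨?_,
    Fin.cons_injective_iff.2 ⟨?_, hw⟩⟩, fun x => ⟨?_, ?_⟩, ?_⟩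
  · rintro ⟨j, hj⟩
    induction j using Fin.cases with
    | zero => exact hcs (hj ▸ hus)
    | succ j => exact hcl (hj ▸ (hwl j).2)
  · rintro ⟨j, rfl⟩
    exact hus.not_isLeaf (hwl j).2
  · rintro ⟨hx, hxp⟩
    rcases hcx x hx with rfl | h | h
    · exact ⟨(0 : Fin (m + 2)), rfl⟩
    · obtain ⟨j, rfl⟩ := hwr.superset ⟨hx, h⟩
      exact ⟨j.succ.succ, rfl⟩
    · rcases hS x hx h with rfl | h
      · exact ⟨(1 : Fin (m + 2)), rfl⟩
      · exact absurd h hxp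
  · rintro ⟨j, rfl⟩
    induction j using Fin.cases with
    | zero => exact ⟨hc, hne c hc hcs⟩
    | succ j =>
      induction j using Fin.cases with
      | zero => exact ⟨hu, hup⟩
      | succ j => exact ⟨(hwl j).1, hne _ (hwl j).1 fun h => h.not_isLeaf (hwl j).2⟩
  · intro j
    induction j using Fin.cases with
    | zero => exact hcr
    | succ j =>
      induction j using Fin.cases with
      | zero => exact hru
      | succ j => exact (hwl j).2.realizes (hwl j).1

/-- The bit is discovered at position `0` and carried upwards. The last clause is needed because a
node at position `1` does not check its own leaf count; its neighbor at position `0` does. -/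
theorem realizes_spine_of_consistent [Finite V] {d : ℕ} {R : ℕ → ℕ → Prop} {G : SimpleGraph V}
    (hG : ∀ v, Spinelike G v → SpineConsistent d R G v) {i m mp : ℕ} {v p : V}
    (hv : Spinelike G v) (hp : Spinelike G p) (hvp : G.Adj v p) (hbv : HasBag d G v i m)
    (hbp : HasBag d G p (i + 1) mp) :
    ∃ b, Realizes d G p v (.spine b i m) ∧ m = leafCount b i ∧ (i = 0 → mp = leafCount b 1) := by
  induction i generalizing m mp v p with
  | zero =>
    rcases hG v hv with ⟨b, hb, u, -, -, hS, hbu⟩ | ⟨i', m', hb, -⟩ | ⟨i', m', hb, -⟩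
    · obtain rfl := hS p hvp hp
      exact ⟨b, realizes_spine_zero hv (Or.inr hp) hS hbv, (hbv.unique hv hb).2,
        fun _ => (hbp.unique hp hbu).2⟩
    · exact absurd (hbv.unique hv hb).1 (by omega)
    · exact absurd (hbv.unique hv hb).1 (by omega)
  | succ i ih =>
    rcases hG v hv with ⟨b, hb, -⟩ | ⟨i', m', hb, -, u, -, -, hS, m'', hbu⟩ |
      ⟨i', m', hb, hm', u, hu, hus, ⟨mu, hbu⟩, u', -, -, -, hS⟩
    · exact absurd (hbv.unique hv hb).1 (by omega)
    · obtain rfl := hS p hvp hp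
      have h1 := (hbv.unique hv hb).1
      have h2 := (hbp.unique hp hbu).1
      omega
    · obtain ⟨h1, rfl⟩ := hbv.unique hv hb
      obtain rfl : i = i' := by omega
      have hup : u ≠ p := by
        rintro rfl
        have := (hbp.unique hp hbu).1
        omega
      have hS' : ∀ x, G.Adj v x → Spinelike G x → x = u ∨ x = p := by
        intro x hx hxs
        have := hS x hx hxs
        have := (hS p hvp hp).resolve_left hup.symm
        rwa [this]
      obtain ⟨b, hr, hmu, hz⟩ := ih hus hv hu.symm hbu hbv
      refine ⟨b, realizes_spine_succ hv (Or.inr hp) hu hus hup hS' hbv hr hmu, ?_, by omega⟩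
      cases i with
      | zero => exact hz rfl
      | succ i => exact hm' (by omega)

/-- A spine node of maximal position exists by finiteness. Ends and middle nodes have a spine
neighbor of larger position, so it is a start, and the part below it is already understood. -/
theorem exists_realizes_of_good [Finite V] [Nonempty V] {d : ℕ} {R : ℕ → ℕ → Prop}
    {G : SimpleGraph V} (hG : ∀ v, Good d R G v) :
    ∃ v b i m, R (i + 2) m ∧ 1 ≤ m ∧ Realizes d G v v (.spine b (i + 2) m) := by
  have hspine : ∃ v, Spinelike G v := by
    obtain ⟨v⟩ := ‹Nonempty V›
    have key : ∀ k v, NearSpine G k v → ∃ v, Spinelike G v := by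
      intro k
      induction k with
      | zero => exact fun v h => ⟨v, h⟩
      | succ k ih =>
        rintro v (h | ⟨w, -, h⟩)
        · exact ih v h
        · exact ih w h
    exact key _ v (hG v).1
  have hcons : ∀ v, Spinelike G v → SpineConsistent d R G v := fun v => (hG v).2
  have hval : ∀ v : {v // Spinelike G v}, ∃ i m, HasBag d G v i m := by
    rintro ⟨v, hv⟩
    rcases hcons v hv with ⟨b, hb, -⟩ | ⟨i, m, hb, -⟩ | ⟨i, m, hb, -⟩
    exacts [⟨_, _, hb⟩, ⟨_, _, hb⟩, ⟨_, _, hb⟩]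
  choose pos hpos using hval
  have : Nonempty {v // Spinelike G v} := hspine.elim fun v hv => ⟨⟨v, hv⟩⟩
  obtain ⟨⟨v, hv⟩, hmax⟩ := Finite.exists_max pos
  have hle : ∀ u i m, Spinelike G u → HasBag d G u i m → i ≤ pos ⟨v, hv⟩ := by
    intro u i m hu hb
    obtain ⟨m', hb'⟩ := hpos ⟨u, hu⟩
    rw [(hb.unique hu hb').1]
    exact hmax ⟨u, hu⟩
  obtain ⟨mv, hbv⟩ := hpos ⟨v, hv⟩
  rcases hcons v hv with ⟨b, hb, u, -, hus, -, hbu⟩ | ⟨i, m, hb, hR, u, hu, hus, hS, mu, hbu⟩ |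
    ⟨i, m, hb, -, -, -, -, -, u, -, hus, ⟨mu, hbu⟩, -⟩
  · have h1 := (hbv.unique hv hb).1
    have h2 := hle u _ _ hus hbu
    omega
  · obtain ⟨b, hr, hmu, -⟩ := realizes_spine_of_consistent hcons hus hv hu.symm hbu hb
    refine ⟨v, b, i, m, hR, ?_, realizes_spine_succ hv (Or.inl rfl) hu hus hu.ne'
      (fun x hx hxs => Or.inl (hS x hx hxs)) hb hr hmu⟩
    obtain ⟨x, hx, hxl⟩ := hv.1
    rw [← hb.2]
    exact (Set.ncard_pos (Set.toFinite _)).2 ⟨x, hx, hxl⟩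
  · have h1 := (hbv.unique hv hb).1
    have h2 := hle u _ _ hus hbu
    omega

/-! ### The tree that unfolds a type -/

/-- The type of the node with address `w`; addresses list the child indices from the node up to the
root. -/
def typeAt (d : ℕ) (τ : NodeType) : List ℕ → NodeType
  | [] => τ
  | j :: w => child d (typeAt d τ w) j

/-- The addresses of nodes of the tree that unfolds `τ`. -/
def IsAddress (d : ℕ) (τ : NodeType) : List ℕ → Prop
  | [] => True
  | j :: w => j < arity (typeAt d τ w) ∧ IsAddress d τ w

/-- The nodes of the tree that unfolds `τ`. -/
abbrev Vertex (d : ℕ) (τ : NodeType) : Type := {w : List ℕ // IsAddress d τ w}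

/-- The tree that unfolds `τ`. -/
def treeGraph (d : ℕ) (τ : NodeType) : SimpleGraph (Vertex d τ) where
  Adj u v := (∃ j, u.1 = j :: v.1) ∨ ∃ j, v.1 = j :: u.1
  symm := ⟨fun _ _ h => h.symm⟩
  loopless := ⟨fun _ h => by
    rcases h with ⟨j, hj⟩ | ⟨j, hj⟩ <;> exact absurd (congrArg List.length hj) (by simp)⟩

section Tree

variable {d : ℕ} {τ : NodeType}

/-- The root. -/
def root (d : ℕ) (τ : NodeType) : Vertex d τ := ⟨[], trivial⟩

/-- The `j`-th child of a node. -/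
def Vertex.child (v : Vertex d τ) (j : ℕ) (hj : j < arity (typeAt d τ v.1)) : Vertex d τ :=
  ⟨j :: v.1, hj, v.2⟩

theorem Vertex.eq_root_or_eq_child (v : Vertex d τ) :
    v = root d τ ∨ ∃ (u : Vertex d τ) (j : ℕ) (hj : j < arity (typeAt d τ u.1)),
      v = u.child j hj := by
  obtain ⟨w, hw⟩ := v
  cases w with
  | nil => exact Or.inl rfl
  | cons j w => exact Or.inr ⟨⟨w, hw.2⟩, j, hw.1, rfl⟩

theorem adj_child (v : Vertex d τ) (j : ℕ) (hj : j < arity (typeAt d τ v.1)) :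
    (treeGraph d τ).Adj v (v.child j hj) := Or.inr ⟨j, rfl⟩

theorem adj_root_iff {x : Vertex d τ} :
    (treeGraph d τ).Adj (root d τ) x ↔
      ∃ (j : ℕ) (hj : j < arity (typeAt d τ (root d τ).1)), x = (root d τ).child j hj := by
  constructor
  · rintro (⟨j, hj⟩ | ⟨j, hj⟩)
    · exact absurd hj (List.cons_ne_nil _ _).symm
    · obtain ⟨w, hw⟩ := x
      obtain rfl : w = [j] := hj
      exact ⟨j, hw.1, rfl⟩
  · rintro ⟨j, hj, rfl⟩
    exact adj_child _ j hj

theorem adj_child_iff {u : Vertex d τ} {k : ℕ} {hk : k < arity (typeAt d τ u.1)} {x : Vertex d τ} :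
    (treeGraph d τ).Adj (u.child k hk) x ↔ x = u ∨
      ∃ (j : ℕ) (hj : j < arity (typeAt d τ (u.child k hk).1)), x = (u.child k hk).child j hj := by
  constructor
  · rintro (⟨j, hj⟩ | ⟨j, hj⟩)
    · exact Or.inl (Subtype.ext (List.cons.inj hj).2.symm)
    · obtain ⟨w, hw⟩ := x
      obtain rfl : w = j :: k :: u.1 := hj
      exact Or.inr ⟨j, hw.1, rfl⟩
  · rintro (rfl | ⟨j, hj, rfl⟩)
    · exact (adj_child _ k hk).symm
    · exact adj_child _ j hj

theorem child_ne_parent (u : Vertex d τ) (k j : ℕ) (hk hj) : (u.child k hk).child j hj ≠ u := by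
  intro h
  have := congrArg (fun v : Vertex d τ => v.1.length) h
  simp only [Vertex.child, List.length_cons] at this
  omega

theorem child_injective (v : Vertex d τ) {j j' : ℕ} {hj hj'} (h : v.child j hj = v.child j' hj') :
    j = j' := (List.cons.inj (congrArg Subtype.val h)).1

theorem edist_root_le (v : Vertex d τ) :
    (treeGraph d τ).edist (root d τ) v ≤ (v.1.length : ℕ∞) := by
  obtain ⟨w, hw⟩ := v
  induction w with
  | nil => exact le_of_eq (SimpleGraph.edist_self)
  | cons j w ih =>
    have h1 := adj_child (d := d) (τ := τ) ⟨w, hw.2⟩ j hw.1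
    calc (treeGraph d τ).edist (root d τ) ⟨j :: w, hw⟩
        ≤ (treeGraph d τ).edist (root d τ) ⟨w, hw.2⟩ +
          (treeGraph d τ).edist ⟨w, hw.2⟩ ⟨j :: w, hw⟩ := SimpleGraph.edist_triangle
      _ ≤ (w.length : ℕ∞) + 1 := by
        gcongr
        · exact ih hw.2
        · exact (SimpleGraph.edist_eq_one_iff_adj.2 h1).le
      _ = ((j :: w).length : ℕ∞) := by simp

theorem length_le_of_edist_root_le {v : Vertex d τ} {T : ℕ}
    (h : (treeGraph d τ).edist (root d τ) v ≤ T) : v.1.length ≤ T := by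
  have key : ∀ {u v : Vertex d τ} (p : (treeGraph d τ).Walk u v),
      v.1.length ≤ u.1.length + p.length := by
    intro u v p
    induction p with
    | nil => simp
    | cons hadj p ih =>
      rw [SimpleGraph.Walk.length_cons]
      rcases hadj with ⟨j, hj⟩ | ⟨j, hj⟩ <;> have := congrArg List.length hj <;>
        rw [List.length_cons] at this <;> omega
  obtain ⟨p, hp⟩ := SimpleGraph.exists_walk_of_edist_ne_top
    (ne_top_of_le_ne_top (ENat.natCast_ne_top T) h)
  rw [← hp, Nat.cast_le] at h
  have h1 : v.1.length ≤ 0 + p.length := key p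
  omega

theorem treeGraph_connected (d : ℕ) (τ : NodeType) : (treeGraph d τ).Connected := by
  have key : ∀ v, (treeGraph d τ).Reachable (root d τ) v := fun v =>
    SimpleGraph.edist_ne_top_iff_reachable.1
      (ne_top_of_le_ne_top (ENat.natCast_ne_top _) (edist_root_le v))
  exact (SimpleGraph.connected_iff _).2 ⟨fun u v => (key u).symm.trans (key v), ⟨root d τ⟩⟩

theorem treeGraph_isTree (d : ℕ) (τ : NodeType) : (treeGraph d τ).IsTree := by
  refine ⟨treeGraph_connected d τ, SimpleGraph.isAcyclic_iff_forall_adj_isBridge.2 ?_⟩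
  have key : ∀ (v : Vertex d τ) (j : ℕ) (hj : j < arity (typeAt d τ v.1)),
      (treeGraph d τ).IsBridge s(v, v.child j hj) := by
    intro v j hj
    rw [SimpleGraph.isBridge_iff]
    rintro ⟨p⟩
    -- Only the deleted edge leads into or out of the subtree below the child.
    have hinv : ∀ {x y : Vertex d τ}
        (p : ((treeGraph d τ).deleteEdges {s(v, v.child j hj)}).Walk x y),
        (j :: v.1 <:+ x.1 ↔ j :: v.1 <:+ y.1) := by
      intro x y p
      induction p with
      | nil => rfl
      | @cons a b _ hadj p ih =>
        rw [← ih]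
        rw [SimpleGraph.deleteEdges_adj, Set.mem_singleton_iff] at hadj
        obtain ⟨⟨k, hk⟩ | ⟨k, hk⟩, hne⟩ := hadj
        · rw [hk, List.suffix_cons_iff]
          refine or_iff_right fun he => hne ?_
          have h1 : a = v.child j hj := Subtype.ext (hk.trans he.symm)
          have h2 : b = v := Subtype.ext (List.cons.inj he).2.symm
          rw [h1, h2, Sym2.eq_swap]
        · rw [hk, List.suffix_cons_iff]
          refine (or_iff_right fun he => hne ?_).symm
          have h1 : b = v.child j hj := Subtype.ext (hk.trans he.symm)
          have h2 : a = v := Subtype.ext (List.cons.inj he).2.symm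
          rw [h1, h2]
    have h1 := (hinv p).2 (List.suffix_refl _)
    have := h1.length_le
    simp at this
  rintro u v (⟨j, hj⟩ | ⟨j, hj⟩)
  · obtain ⟨w, hw⟩ := u
    obtain rfl : w = j :: v.1 := hj
    rw [Sym2.eq_swap]
    exact key v j hw.1
  · obtain ⟨w, hw⟩ := v
    obtain rfl : w = j :: u.1 := hj
    exact key u j hw.1

end Tree

/-! ### Graphs that realize a type are isomorphic to its unfolding -/

/-- Both neighbors extend to shortest paths from `r` to `z`, and a tree has only one path. -/
theorem eq_of_adj_of_dist_eq {G : SimpleGraph V} (hG : G.IsTree) {r x y z : V} (hx : G.Adj x z)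
    (hy : G.Adj y z) (hdx : G.dist r z = G.dist r x + 1) (hdy : G.dist r z = G.dist r y + 1) :
    x = y := by
  obtain ⟨p, -, hp⟩ := hG.connected.exists_path_of_dist r x
  obtain ⟨q, -, hq⟩ := hG.connected.exists_path_of_dist r y
  have hp' : (p.concat hx).IsPath := SimpleGraph.Walk.isPath_of_length_eq_dist _ (by
    rw [SimpleGraph.Walk.length_concat, hp, hdx])
  have hq' : (q.concat hy).IsPath := SimpleGraph.Walk.isPath_of_length_eq_dist _ (by
    rw [SimpleGraph.Walk.length_concat, hq, hdy])
  have := congrArg (fun p : G.Path r z => p.1.penultimate)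
    ((hG.isAcyclic.subsingleton_path _ _).elim ⟨_, hp'⟩ ⟨_, hq'⟩)
  simpa using this

/-- Following addresses from `r` gives a map that is locally bijective; it is onto by connectedness.
In a tree, never stepping back means that the distance to `r` equals the length of the address,
which gives injectivity. -/
theorem nonempty_iso_of_realizes {d : ℕ} {τ : NodeType} {G : SimpleGraph V} (hG : G.IsTree) {r : V}
    (h : Realizes d G r r τ) : Nonempty (treeGraph d τ ≃g G) := by
  have hex : ∀ p v σ, ∃ w : ℕ → V, Realizes d G p v σ →
      (∀ i < arity σ, ∀ j < arity σ, w i = w j → i = j) ∧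
      (∀ x, (G.Adj v x ∧ x ≠ p) ↔ ∃ j < arity σ, w j = x) ∧
      ∀ j < arity σ, Realizes d G v (w j) (child d σ j) := by
    intro p v σ
    by_cases hr : Realizes d G p v σ
    · obtain ⟨w, hw, hadj, hc⟩ := realizes_iff.1 hr
      refine ⟨fun j => if hj : j < arity σ then w ⟨j, hj⟩ else v, fun _ =>
        ⟨fun i hi j hj hij => ?_, fun x => ?_, fun j hj => ?_⟩⟩
      · simp only [hi, hj, dif_pos] at hij
        exact congrArg Fin.val (hw hij)
      · rw [hadj]
        constructor
        · rintro ⟨j, rfl⟩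
          exact ⟨j, j.2, by simp⟩
        · rintro ⟨j, hj, rfl⟩
          exact ⟨⟨j, hj⟩, by simp [hj]⟩
      · simpa [hj] using hc ⟨j, hj⟩
    · exact ⟨fun _ => v, fun h => absurd h hr⟩
  choose next hnext using hex
  -- The pair of the parent and the node reached; the root counts as its own parent.
  let state : List ℕ → V × V := fun w => w.rec (r, r)
    fun j w s => (s.2, next s.1 s.2 (typeAt d τ w) j)
  have hstate : ∀ j w, state (j :: w) =
      ((state w).2, next (state w).1 (state w).2 (typeAt d τ w) j) := fun _ _ => rfl
  have hreal : ∀ w, IsAddress d τ w → Realizes d G (state w).1 (state w).2 (typeAt d τ w) := by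
    intro w
    induction w with
    | nil => exact fun _ => h
    | cons j w ih =>
      intro hw
      exact (hnext _ _ _ (ih hw.2)).2.2 j hw.1
  have hadj : ∀ j w, IsAddress d τ (j :: w) →
      G.Adj (state w).2 (state (j :: w)).2 ∧ (state (j :: w)).2 ≠ (state w).1 := fun j w hw =>
    ((hnext _ _ _ (hreal w hw.2)).2.1 _).2 ⟨j, hw.1, rfl⟩
  have hle : ∀ w, IsAddress d τ w → G.dist r (state w).2 ≤ w.length := by
    intro w
    induction w with
    | nil => exact fun _ => SimpleGraph.dist_self.le
    | cons j w ih =>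
      intro hw
      have h1 := hG.connected.dist_triangle (u := r) (v := (state w).2) (w := (state (j :: w)).2)
      rw [SimpleGraph.dist_eq_one_iff_adj.2 (hadj j w hw).1] at h1
      exact h1.trans (Nat.succ_le_succ (ih hw.2))
  have hdist : ∀ w, IsAddress d τ w → G.dist r (state w).2 = w.length := by
    intro w
    induction w with
    | nil => exact fun _ => SimpleGraph.dist_self
    | cons j w ih =>
      intro hw
      obtain ⟨h1, h2⟩ := hadj j w hw
      have h3 := ih hw.2
      rcases hG.dist_eq_dist_add_one_of_adj r h1 with h4 | h4
      · cases w with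
        | nil =>
          rw [List.length_nil] at h3
          omega
        | cons k w =>
          -- If the distance dropped, the new node would be the unique neighbor closer to `r`, that
          -- is the parent.
          refine absurd (eq_of_adj_of_dist_eq hG h1.symm (hadj k w hw.2).1 h4 ?_) h2
          rcases hG.dist_eq_dist_add_one_of_adj r (hadj k w hw.2).1 with h5 | h5
          · have h6 := hle w hw.2.2
            rw [List.length_cons] at h3
            omega
          · exact h5
      · rw [h4, h3, List.length_cons]
  have hinj : ∀ w w', IsAddress d τ w → IsAddress d τ w' → (state w).2 = (state w').2 →
      w = w' := by
    intro w
    induction w with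
    | nil =>
      intro w' _ hw' he
      have := hdist w' hw'
      rw [← he] at this
      change G.dist r r = _ at this
      rw [SimpleGraph.dist_self] at this
      exact (List.length_eq_zero_iff.1 this.symm).symm
    | cons j w ih =>
      intro w' hw hw' he
      have hl := hdist w' hw'
      rw [← he, hdist _ hw] at hl
      cases w' with
      | nil => simp at hl
      | cons j' w' =>
        have hww : w = w' := by
          refine ih w' hw.2 hw'.2 (eq_of_adj_of_dist_eq hG (r := r) (hadj j w hw).1
            (he ▸ (hadj j' w' hw').1) ?_ ?_)
          · rw [hdist _ hw, hdist _ hw.2, List.length_cons]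
          · rw [hdist _ hw, hdist _ hw'.2, hl, List.length_cons]
        subst hww
        rw [(hnext _ _ _ (hreal w hw.2)).1 j hw.1 j' hw'.1 he]
  have hnbr : ∀ w, IsAddress d τ w → ∀ x, G.Adj (state w).2 x → ∃ w', IsAddress d τ w' ∧
      (state w').2 = x ∧ ((∃ j, w = j :: w') ∨ ∃ j, w' = j :: w) := by
    intro w hw x hx
    by_cases hxp : x = (state w).1
    · cases w with
      | nil =>
        subst hxp
        exact absurd rfl hx.ne
      | cons j w => exact ⟨w, hw.2, hxp.symm, Or.inl ⟨j, rfl⟩⟩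
    · obtain ⟨j, hj, rfl⟩ := ((hnext _ _ _ (hreal w hw)).2.1 x).1 ⟨hx, hxp⟩
      exact ⟨j :: w, ⟨hj, hw⟩, rfl, Or.inr ⟨j, rfl⟩⟩
  have hsurj : ∀ x, ∃ w, IsAddress d τ w ∧ (state w).2 = x := by
    intro x
    obtain ⟨p⟩ := hG.connected r x
    have : ∀ {y x : V} (p : G.Walk y x), (∃ w, IsAddress d τ w ∧ (state w).2 = y) →
        ∃ w, IsAddress d τ w ∧ (state w).2 = x := by
      intro y x p
      induction p with
      | nil => exact id
      | cons hyz p ih =>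
        rintro ⟨w, hw, rfl⟩
        obtain ⟨w', hw', he, -⟩ := hnbr w hw _ hyz
        exact ih ⟨w', hw', he⟩
    exact this p ⟨[], trivial, rfl⟩
  refine ⟨⟨Equiv.ofBijective (fun w : Vertex d τ => (state w.1).2)
    ⟨fun w w' he => Subtype.ext (hinj _ _ w.2 w'.2 he), fun x => ?_⟩, ?_⟩⟩
  · obtain ⟨w, hw, he⟩ := hsurj x
    exact ⟨⟨w, hw⟩, he⟩
  · rintro ⟨w, hw⟩ ⟨w', hw'⟩
    change G.Adj (state w).2 (state w').2 ↔ _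
    constructor
    · intro hx
      obtain ⟨w'', hw'', he, hc⟩ := hnbr w hw _ hx
      obtain rfl := hinj _ _ hw'' hw' he
      exact hc
    · rintro (⟨j, rfl⟩ | ⟨j, rfl⟩)
      · exact (hadj j w' hw).1.symm
      · exact (hadj j w hw').1

/-! ### The checker accepts the trees that unfold the type of a start of a spine -/

section Codes

variable {d : ℕ} {τ : NodeType}

theorem realizes_child (u : Vertex d τ) (k : ℕ) (hk : k < arity (typeAt d τ u.1))
    (h : ∀ j hj, Realizes d (treeGraph d τ) (u.child k hk) ((u.child k hk).child j hj)
      (child d (typeAt d τ (u.child k hk).1) j)) :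
    Realizes d (treeGraph d τ) u (u.child k hk) (typeAt d τ (u.child k hk).1) := by
  refine realizes_iff.2 ⟨fun j => (u.child k hk).child j j.2, fun i j hij =>
    Fin.ext (child_injective _ hij), fun x => ⟨?_, ?_⟩, fun j => h j j.2⟩
  · rintro ⟨hx, hxu⟩
    obtain ⟨j, hj, rfl⟩ := (adj_child_iff.1 hx).resolve_left hxu
    exact ⟨⟨j, hj⟩, rfl⟩
  · rintro ⟨j, rfl⟩
    exact ⟨adj_child _ _ _, child_ne_parent u k j hk _⟩

theorem realizes_child_leaf {u : Vertex d τ} {k : ℕ} {hk : k < arity (typeAt d τ u.1)}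
    (h : child d (typeAt d τ u.1) k = .leaf) :
    Realizes d (treeGraph d τ) u (u.child k hk) .leaf := by
  have h' : typeAt d τ (u.child k hk).1 = .leaf := h
  rw [← h']
  refine realizes_child u k hk fun j hj => absurd hj ?_
  rw [h']
  exact Nat.not_lt_zero _

theorem realizes_child_code {u : Vertex d τ} {k e i : ℕ} {hk : k < arity (typeAt d τ u.1)}
    (h : child d (typeAt d τ u.1) k = .code e i) :
    Realizes d (treeGraph d τ) u (u.child k hk) (.code e i) := by
  induction e generalizing u k i with
  | zero =>
    have h' : typeAt d τ (u.child k hk).1 = .code 0 i := h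
    rw [← h']
    refine realizes_child u k hk fun j hj => ?_
    have hj' : child d (typeAt d τ (u.child k hk).1) j = .leaf := by rw [h']; rfl
    rw [hj']
    exact realizes_child_leaf hj'
  | succ e ih =>
    have h' : typeAt d τ (u.child k hk).1 = .code (e + 1) i := h
    rw [← h']
    refine realizes_child u k hk fun j hj => ?_
    have hj' : child d (typeAt d τ (u.child k hk).1) j =
      .code e (j * selfBase i + i / selfBase i ^ j % selfBase i) := by rw [h']; rfl
    rw [hj']
    exact ih hj'

theorem isLeaf_child {u : Vertex d τ} {k : ℕ} {hk : k < arity (typeAt d τ u.1)}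
    (h : child d (typeAt d τ u.1) k = .leaf) : IsLeaf (treeGraph d τ) (u.child k hk) :=
  isLeaf_of_realizes_leaf (adj_child _ _ _) (realizes_child_leaf h)

theorem child_eq_spine {σ : NodeType} {b : Bool} {i m j : ℕ}
    (h : child d σ j = .spine b i m) :
    j = 1 ∧ m = leafCount b i ∧ ∃ m', σ = .spine b (i + 1) m' := by
  rcases σ with - | ⟨- | e, i'⟩ | ⟨b', - | i', m'⟩
  · exact absurd h (by simp [child])
  · exact absurd h (by simp [child])
  · exact absurd h (by simp [child])
  · rcases j with - | j <;> exact absurd h (by simp [child])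
  · rcases j with - | - | j
    · exact absurd h (by simp [child])
    · simp only [child, NodeType.spine.injEq] at h
      obtain ⟨rfl, rfl, rfl⟩ := h
      exact ⟨rfl, rfl, m', rfl⟩
    · exact absurd h (by simp [child])

theorem child_eq_code {σ : NodeType} {e i j : ℕ} (h : child d σ j = .code e i) :
    (e = d ∧ ∃ b m, σ = .spine b i m) ∨ ∃ i', σ = .code (e + 1) i' := by
  rcases σ with - | ⟨- | e', i'⟩ | ⟨b', - | i', m'⟩
  · exact absurd h (by simp [child])
  · exact absurd h (by simp [child])
  · simp only [child, NodeType.code.injEq] at h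
    obtain ⟨rfl, rfl⟩ := h
    exact Or.inr ⟨i', rfl⟩
  · rcases j with - | j
    · simp only [child, NodeType.code.injEq] at h
      obtain ⟨rfl, rfl⟩ := h
      exact Or.inl ⟨rfl, b', m', rfl⟩
    · exact absurd h (by simp [child])
  · rcases j with - | - | j
    · simp only [child, NodeType.code.injEq] at h
      obtain ⟨rfl, rfl⟩ := h
      exact Or.inl ⟨rfl, b', m', rfl⟩
    · exact absurd h (by simp [child])
    · exact absurd h (by simp [child])

theorem child_spine_zero (b : Bool) (i m : ℕ) : child d (.spine b i m) 0 = .code d i := by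
  cases i <;> rfl

theorem leafCount_pos (b : Bool) (i : ℕ) : 1 ≤ leafCount b i := by
  rcases i with - | - | i <;> cases b <;> simp [leafCount]

/-- The number of children of a node of the spine that are not leaves. -/
def innerCount : ℕ → ℕ
  | 0 => 1
  | _ + 1 => 2

theorem arity_spine (b : Bool) (i m : ℕ) : arity (.spine b i m) = m + innerCount i := by
  cases i <;> rfl

theorem child_spine_leaf (b : Bool) (i m j : ℕ) :
    child d (.spine b i m) (innerCount i + j) = .leaf := by
  cases i with
  | zero =>
    change child d _ (1 + j) = _
    rw [add_comm]
    rfl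
  | succ i =>
    change child d _ (2 + j) = _
    rw [add_comm 2 j]
    rfl

theorem NearSpine.mono {V : Type} {G : SimpleGraph V} {v : V} {k n : ℕ} (h : NearSpine G k v)
    (hkn : k ≤ n) : NearSpine G n v := by
  induction n, hkn using Nat.le_induction with
  | base => exact h
  | succ n _ ih => exact Or.inl ih

end Codes

/-! ### Local structure of the unfolded caterpillar -/

section Spine

variable {d l q : ℕ} {b : Bool}

local notation "tp" => typeAt d (NodeType.spine b (l + 2) q)
local notation "VT" => Vertex d (NodeType.spine b (l + 2) q)
local notation "T" => treeGraph d (NodeType.spine b (l + 2) q)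

theorem typeAt_eq_spine {w : List ℕ} {b' : Bool} {i m : ℕ} (h : tp w = .spine b' i m) :
    b' = b ∧ i + w.length = l + 2 ∧ (w = [] ∧ m = q ∨ m = leafCount b i) := by
  induction w generalizing i m with
  | nil =>
    simp only [typeAt, NodeType.spine.injEq] at h
    obtain ⟨rfl, rfl, rfl⟩ := h
    exact ⟨rfl, rfl, Or.inl ⟨rfl, rfl⟩⟩
  | cons j w ih =>
    obtain ⟨-, hm, m', h'⟩ := child_eq_spine h
    obtain ⟨rfl, hl, -⟩ := ih h'
    refine ⟨rfl, ?_, Or.inr hm⟩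
    rw [List.length_cons]
    omega

theorem one_le_leaves (hq : 1 ≤ q) {w : List ℕ} {b' : Bool} {i m : ℕ}
    (h : tp w = .spine b' i m) : 1 ≤ m := by
  obtain ⟨-, -, ⟨-, rfl⟩ | rfl⟩ := typeAt_eq_spine h
  · exact hq
  · exact leafCount_pos _ _

theorem not_isLeaf_of_typeAt_eq_spine (hq : 1 ≤ q) {v : VT} {b' : Bool} {i m : ℕ}
    (h : tp v.1 = .spine b' i m) : ¬IsLeaf T v := by
  have hm := one_le_leaves hq h
  have h2 : 1 < arity (tp v.1) := by
    rw [h]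
    cases i <;> simp only [arity] <;> omega
  exact fun hl => Nat.zero_ne_one (child_injective v
    (hl.eq_of_adj (adj_child v 0 (by omega)) (adj_child v 1 h2)))

theorem not_isLeaf_of_typeAt_ne_leaf (hq : 1 ≤ q) {v : VT} (h : tp v.1 ≠ .leaf) : ¬IsLeaf T v := by
  rcases ht : tp v.1 with - | ⟨e, i⟩ | ⟨b', i, m⟩
  · exact absurd ht h
  · obtain rfl | ⟨u, k, hk, rfl⟩ := v.eq_root_or_eq_child
    · exact absurd ht (by simp [root, typeAt])
    · exact not_isLeaf_of_realizes_code (adj_child u k hk) (realizes_child_code ht)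
  · exact not_isLeaf_of_typeAt_eq_spine hq ht

theorem spinelike_of_typeAt_eq_spine (hq : 1 ≤ q) {v : VT} {b' : Bool} {i m : ℕ}
    (h : tp v.1 = .spine b' i m) : Spinelike T v := by
  have hm := one_le_leaves hq h
  have ha : arity (tp v.1) = m + innerCount i := by rw [h, arity_spine]
  have hi : 1 ≤ innerCount i := by cases i <;> simp [innerCount]
  have hcode : ∀ hj, ¬IsLeaf T (v.child 0 hj) := fun hj =>
    not_isLeaf_of_realizes_code (adj_child v 0 hj) (realizes_child_code (i := i) (e := d)
      (by rw [h, child_spine_zero]))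
  refine ⟨⟨v.child (innerCount i + 0) (by omega), adj_child _ _ _, isLeaf_child ?_⟩,
    v.child 0 (by omega), adj_child _ _ _, ?_⟩
  · rw [h, child_spine_leaf]
  · cases i with
    | zero =>
      obtain rfl | ⟨u, k, hk, rfl⟩ := v.eq_root_or_eq_child
      · exact absurd h (by simp [root, typeAt])
      · obtain ⟨-, -, m', hu⟩ := child_eq_spine h
        exact ⟨u, (adj_child u k hk).symm, child_ne_parent u k 0 hk _, hcode _,
          not_isLeaf_of_typeAt_eq_spine hq hu⟩
    | succ i =>
      have h1 : 1 < arity (tp v.1) := by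
        rw [h]
        exact Nat.succ_lt_succ (Nat.succ_pos m)
      refine ⟨v.child 1 h1, adj_child _ _ _, fun he => Nat.zero_ne_one (child_injective v he),
        hcode _, not_isLeaf_of_typeAt_eq_spine (b' := b') (i := i) (m := leafCount b' i) hq ?_⟩
      change child d (tp v.1) 1 = _
      rw [h]
      rfl

theorem exists_typeAt_eq_spine (hq : 1 ≤ q) {v : VT} (h : Spinelike T v) :
    ∃ i m, tp v.1 = .spine b i m := by
  rcases ht : tp v.1 with - | ⟨e, i⟩ | ⟨b', i, m⟩
  · obtain rfl | ⟨u, k, hk, rfl⟩ := v.eq_root_or_eq_child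
    · exact absurd ht (by simp [root, typeAt])
    · exact absurd (isLeaf_child ht) h.not_isLeaf
  · obtain rfl | ⟨u, k, hk, rfl⟩ := v.eq_root_or_eq_child
    · exact absurd ht (by simp [root, typeAt])
    · refine absurd h (not_spinelike_of_realizes_code (not_isLeaf_of_typeAt_ne_leaf hq ?_)
        (realizes_child_code ht))
      intro hu
      rw [hu] at hk
      exact Nat.not_lt_zero _ hk
  · obtain ⟨rfl, -⟩ := typeAt_eq_spine ht
    exact ⟨i, m, rfl⟩

theorem hasBag_of_typeAt_eq_spine (hq : 1 ≤ q) {v : VT} {b' : Bool} {i m : ℕ}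
    (h : tp v.1 = .spine b' i m) : HasBag d T v i m := by
  have ha : arity (tp v.1) = m + innerCount i := by rw [h, arity_spine]
  have hi : 1 ≤ innerCount i := by cases i <;> simp [innerCount]
  have hcode : child d (tp v.1) 0 = .code d i := by rw [h, child_spine_zero]
  have hleaf : ∀ j, child d (tp v.1) (innerCount i + j) = .leaf := fun j => by
    rw [h, child_spine_leaf]
  have hnbr : ∀ x, (T).Adj v x → (∃ hj, x = v.child 0 hj) ∨ Spinelike T x ∨
      ∃ j hj, j < m ∧ x = v.child (innerCount i + j) hj := by
    have hc : ∀ j hj, (∃ hj', v.child j hj = v.child 0 hj') ∨ Spinelike T (v.child j hj) ∨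
        ∃ j' hj', j' < m ∧ v.child j hj = v.child (innerCount i + j') hj' := by
      intro j hj
      rcases lt_or_ge j (innerCount i) with hlt | hge
      · rcases i with - | i
        · obtain rfl : j = 0 := by simp only [innerCount] at hlt; omega
          exact Or.inl ⟨_, rfl⟩
        · rcases j with - | - | j
          · exact Or.inl ⟨_, rfl⟩
          · refine Or.inr (Or.inl (spinelike_of_typeAt_eq_spine (b' := b') (i := i)
              (m := leafCount b' i) hq ?_))
            change child d (tp v.1) 1 = _
            rw [h]
            rfl
          · simp only [innerCount] at hlt
            omega
      · obtain ⟨j', rfl⟩ := Nat.exists_eq_add_of_le hge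
        exact Or.inr (Or.inr ⟨j', hj, by omega, rfl⟩)
    intro x hx
    obtain rfl | ⟨u, k, hk, rfl⟩ := v.eq_root_or_eq_child
    · obtain ⟨j, hj, rfl⟩ := adj_root_iff.1 hx
      exact hc j hj
    · rcases adj_child_iff.1 hx with rfl | ⟨j, hj, rfl⟩
      · obtain ⟨-, -, m', hu⟩ := child_eq_spine h
        exact Or.inr (Or.inl (spinelike_of_typeAt_eq_spine hq hu))
      · exact hc j hj
  refine ⟨⟨v.child 0 (by omega), adj_child _ _ _, realizes_child_code hcode, fun x hx => ?_⟩, ?_⟩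
  · rcases hnbr x hx with ⟨_, rfl⟩ | hs | ⟨j, hj, -, rfl⟩
    · exact Or.inl rfl
    · exact Or.inr (Or.inr hs)
    · exact Or.inr (Or.inl (isLeaf_child (hleaf j)))
  · have hr : {x | (T).Adj v x ∧ IsLeaf T x} =
        Set.range fun j : Fin m => v.child (innerCount i + j) (by omega) := by
      ext x
      constructor
      · rintro ⟨hx, hxl⟩
        rcases hnbr x hx with ⟨_, rfl⟩ | hs | ⟨j, hj, hjm, rfl⟩
        · exact absurd hxl (not_isLeaf_of_realizes_code hx (realizes_child_code hcode))
        · exact absurd hxl hs.not_isLeaf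
        · exact ⟨⟨j, hjm⟩, rfl⟩
      · rintro ⟨j, rfl⟩
        exact ⟨adj_child _ _ _, isLeaf_child (hleaf j)⟩
    rw [hr, ← Set.image_univ, Set.ncard_image_of_injective, Set.ncard_univ, Nat.card_fin]
    intro j j' hjj
    exact Fin.ext (Nat.add_left_cancel (child_injective v hjj))

theorem child_eq_of_spinelike (hq : 1 ≤ q) {v : VT} {j : ℕ} {hj : j < arity (tp v.1)}
    (h : Spinelike T (v.child j hj)) :
    j = 1 ∧ ∃ i m, tp v.1 = .spine b (i + 1) m ∧ HasBag d T (v.child j hj) i (leafCount b i) := by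
  obtain ⟨i, m, ht⟩ := exists_typeAt_eq_spine hq h
  obtain ⟨rfl, rfl, m', hv⟩ := child_eq_spine ht
  exact ⟨rfl, i, m', hv, hasBag_of_typeAt_eq_spine hq ht⟩

theorem exists_spine_child (hq : 1 ≤ q) {v : VT} {b' : Bool} {i m : ℕ}
    (h : tp v.1 = .spine b' (i + 1) m) : ∃ hj : 1 < arity (tp v.1),
      Spinelike T (v.child 1 hj) ∧ HasBag d T (v.child 1 hj) i (leafCount b' i) := by
  have h1 : 1 < arity (tp v.1) := by
    rw [h]
    exact Nat.succ_lt_succ (Nat.succ_pos m)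
  have ht : tp (v.child 1 h1).1 = .spine b' i (leafCount b' i) := by
    change child d (tp v.1) 1 = _
    rw [h]
    rfl
  exact ⟨h1, spinelike_of_typeAt_eq_spine hq ht, hasBag_of_typeAt_eq_spine hq ht⟩

theorem spineConsistent_treeGraph (hq : 1 ≤ q) {R : ℕ → ℕ → Prop} (hR : R (l + 2) q) {v : VT}
    (hv : Spinelike T v) : SpineConsistent d R T v := by
  obtain ⟨i, m, ht⟩ := exists_typeAt_eq_spine hq hv
  have hb := hasBag_of_typeAt_eq_spine hq ht
  obtain ⟨-, hlen, hm⟩ := typeAt_eq_spine ht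
  obtain rfl | ⟨p, k, hk, rfl⟩ := v.eq_root_or_eq_child
  · obtain rfl : i = l + 2 := hlen
    obtain ⟨hj, hus, hub⟩ := exists_spine_child hq ht
    obtain rfl : q = m := (NodeType.spine.inj ht).2.2
    refine Or.inr (Or.inl ⟨l, q, hb, hR, _, adj_child _ _ hj, hus, fun x hx hxs => ?_, _, hub⟩)
    obtain ⟨j, hj', rfl⟩ := adj_root_iff.1 hx
    obtain ⟨rfl, -⟩ := child_eq_of_spinelike hq hxs
    rfl
  · obtain ⟨-, hm, m', hp⟩ := child_eq_spine ht
    have hps := spinelike_of_typeAt_eq_spine hq hp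
    have hpb := hasBag_of_typeAt_eq_spine hq hp
    cases i with
    | zero =>
      obtain ⟨-, hlen', hm'⟩ := typeAt_eq_spine hp
      -- Only the root has a free leaf count, and its position `l + 2` is not `1`.
      have hm' : m' = leafCount b 1 := by
        refine hm'.resolve_left fun h => ?_
        rw [h.1, List.length_nil] at hlen'
        omega
      refine Or.inl ⟨b, hm ▸ hb, p, (adj_child p k hk).symm, hps, fun x hx hxs => ?_, hm' ▸ hpb⟩
      rcases adj_child_iff.1 hx with rfl | ⟨j, hj, rfl⟩
      · rfl
      · obtain ⟨-, i', m'', ht', -⟩ := child_eq_of_spinelike hq hxs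
        rw [ht] at ht'
        exact absurd (NodeType.spine.inj ht').2.1 (by omega)
    | succ i =>
      obtain ⟨hj, hus, hub⟩ := exists_spine_child hq ht
      refine Or.inr (Or.inr ⟨i, m, hb, fun hi => ?_, _, adj_child _ _ hj, hus, ⟨_, hub⟩, p,
        (adj_child p k hk).symm, hps, ⟨_, hpb⟩, fun x hx hxs => ?_⟩)
      · obtain ⟨i', rfl⟩ := Nat.exists_eq_add_of_le' hi
        exact hm
      · rcases adj_child_iff.1 hx with rfl | ⟨j, hj, rfl⟩
        · exact Or.inr rfl
        · obtain ⟨rfl, -⟩ := child_eq_of_spinelike hq hxs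
          exact Or.inl rfl

theorem level_le {w : List ℕ} {e i : ℕ} (h : tp w = .code e i) : e ≤ d := by
  induction w generalizing e i with
  | nil => exact absurd h (by simp [typeAt])
  | cons j w ih =>
    rcases child_eq_code h with ⟨rfl, -⟩ | ⟨i', h'⟩
    · exact le_rfl
    · exact (Nat.le_succ e).trans (ih h')

theorem nearSpine_treeGraph (hq : 1 ≤ q) (v : VT) : NearSpine T (d + 2) v := by
  have hs : ∀ (v : VT) (b' i m), tp v.1 = .spine b' i m → NearSpine T 0 v :=
    fun v b' i m h => spinelike_of_typeAt_eq_spine hq h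
  have hcode : ∀ (k e i : ℕ) (v : VT), tp v.1 = .code e i → e + k = d → NearSpine T (k + 1) v := by
    intro k
    induction k with
    | zero =>
      intro e i v ht he
      obtain rfl | ⟨u, j, hj, rfl⟩ := v.eq_root_or_eq_child
      · exact absurd ht (by simp [root, typeAt])
      · rcases child_eq_code ht with ⟨-, b', m, hu⟩ | ⟨i', hu⟩
        · exact Or.inr ⟨u, (adj_child u j hj).symm, hs u _ _ _ hu⟩
        · have := level_le hu
          omega
    | succ k ih =>
      intro e i v ht he
      obtain rfl | ⟨u, j, hj, rfl⟩ := v.eq_root_or_eq_child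
      · exact absurd ht (by simp [root, typeAt])
      · rcases child_eq_code ht with ⟨-, b', m, hu⟩ | ⟨i', hu⟩
        · exact Or.inr ⟨u, (adj_child u j hj).symm, (hs u _ _ _ hu).mono (Nat.zero_le _)⟩
        · exact Or.inr ⟨u, (adj_child u j hj).symm, ih _ _ _ hu (by omega)⟩
  have hcode' : ∀ (v : VT) (e i : ℕ), tp v.1 = .code e i → NearSpine T (d + 1) v := by
    intro v e i ht
    have := level_le ht
    exact (hcode (d - e) e i v ht (by omega)).mono (by omega)
  rcases ht : tp v.1 with - | ⟨e, i⟩ | ⟨b', i, m⟩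
  · obtain rfl | ⟨u, j, hj, rfl⟩ := v.eq_root_or_eq_child
    · exact absurd ht (by simp [root, typeAt])
    · refine Or.inr ⟨u, (adj_child u j hj).symm, ?_⟩
      rcases hu : tp u.1 with - | ⟨e, i⟩ | ⟨b', i, m⟩
      · rw [hu] at hj
        exact absurd hj (Nat.not_lt_zero _)
      · exact hcode' u e i hu
      · exact (hs u _ _ _ hu).mono (Nat.zero_le _)
  · exact (hcode' v e i ht).mono (Nat.le_succ _)
  · exact (hs v _ _ _ ht).mono (Nat.zero_le _)

theorem good_treeGraph (hq : 1 ≤ q) {R : ℕ → ℕ → Prop} (hR : R (l + 2) q) (v : VT) :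
    Good d R T v :=
  ⟨nearSpine_treeGraph hq v, spineConsistent_treeGraph hq hR⟩

theorem IsEnd.eq_bit (hq : 1 ≤ q) {v : VT} {b' : Bool} (h : IsEnd d T b' v) : b' = b := by
  obtain ⟨i, m, ht⟩ := exists_typeAt_eq_spine hq h.1
  obtain ⟨rfl, rfl⟩ := h.2.unique h.1 (hasBag_of_typeAt_eq_spine hq ht)
  obtain ⟨-, hlen, ⟨hv, -⟩ | hm⟩ := typeAt_eq_spine ht
  · rw [hv, List.length_nil] at hlen
    omega
  · revert hm
    cases b <;> cases b' <;> simp [leafCount]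

theorem exists_isEnd (hq : 1 ≤ q) : ∃ v : VT, IsEnd d T b v := by
  have key : ∀ k i, i + k = l + 2 → ∃ (v : VT) (m : ℕ), tp v.1 = .spine b i m := by
    intro k
    induction k with
    | zero =>
      rintro i rfl
      exact ⟨root _ _, q, rfl⟩
    | succ k ih =>
      intro i hi
      obtain ⟨v, m, hv⟩ := ih (i + 1) (by omega)
      obtain ⟨hj, -⟩ := exists_spine_child hq hv
      refine ⟨v.child 1 hj, leafCount b i, ?_⟩
      change child d (tp v.1) 1 = _
      rw [hv]
      rfl
  obtain ⟨v, m, hv⟩ := key (l + 2) 0 (by omega)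
  obtain ⟨-, hlen, ⟨hv', -⟩ | rfl⟩ := typeAt_eq_spine hv
  · rw [hv', List.length_nil] at hlen
    omega
  · exact ⟨v, spinelike_of_typeAt_eq_spine hq hv, hasBag_of_typeAt_eq_spine hq hv⟩

end Spine

/-! ### Sizes and heights -/

section Size

variable {d : ℕ}

theorem typeAt_append (τ : NodeType) (w : List ℕ) (j : ℕ) :
    typeAt d τ (w ++ [j]) = typeAt d (child d τ j) w := by
  induction w with
  | nil => rfl
  | cons k w ih => simp only [List.cons_append, typeAt, ih]

theorem isAddress_append (τ : NodeType) (w : List ℕ) (j : ℕ) :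
    IsAddress d τ (w ++ [j]) ↔ j < arity τ ∧ IsAddress d (child d τ j) w := by
  induction w with
  | nil => rfl
  | cons k w ih =>
    simp only [List.cons_append, IsAddress, typeAt_append, ih]
    tauto

/-- The tree that unfolds `τ` has `s` nodes. -/
def HasSize (d : ℕ) (τ : NodeType) (s : ℕ) : Prop :=
  ∃ F : Finset (List ℕ), (∀ w, w ∈ F ↔ IsAddress d τ w) ∧ F.card = s

theorem hasSize_of_child {τ : NodeType} (s : ℕ → ℕ)
    (h : ∀ j < arity τ, HasSize d (child d τ j) (s j)) :
    HasSize d τ (1 + ∑ j ∈ Finset.range (arity τ), s j) := by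
  have hex : ∀ j, ∃ F : Finset (List ℕ), j < arity τ →
      (∀ w, w ∈ F ↔ IsAddress d (child d τ j) w) ∧ F.card = s j := by
    intro j
    by_cases hj : j < arity τ
    · obtain ⟨F, hF⟩ := h j hj
      exact ⟨F, fun _ => hF⟩
    · exact ⟨∅, fun h => absurd h hj⟩
  choose F hF using hex
  have hinj : ∀ j : ℕ, Function.Injective fun w : List ℕ => w ++ [j] := fun j =>
    List.append_left_injective [j]
  -- A nonempty address ends with the index of a child of the root, so the last entry partitions the
  -- addresses.
  refine ⟨insert [] ((Finset.range (arity τ)).biUnion fun j => (F j).image (· ++ [j])),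
    fun w => ?_, ?_⟩
  · rw [Finset.mem_insert, Finset.mem_biUnion]
    constructor
    · rintro (rfl | ⟨j, hj, hw⟩)
      · trivial
      · obtain ⟨w', hw', rfl⟩ := Finset.mem_image.1 hw
        rw [Finset.mem_range] at hj
        exact (isAddress_append _ _ _).2 ⟨hj, ((hF j hj).1 w').1 hw'⟩
    · intro hw
      rcases List.eq_nil_or_concat w with rfl | ⟨w', j, rfl⟩
      · exact Or.inl rfl
      · rw [List.concat_eq_append] at hw ⊢
        obtain ⟨hj, hw'⟩ := (isAddress_append _ _ _).1 hw
        exact Or.inr ⟨j, Finset.mem_range.2 hj,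
          Finset.mem_image.2 ⟨w', ((hF j hj).1 w').2 hw', rfl⟩⟩
  · rw [Finset.card_insert_of_notMem, Finset.card_biUnion, add_comm]
    · congr 1
      refine Finset.sum_congr rfl fun j hj => ?_
      rw [Finset.card_image_of_injective _ (hinj j), (hF j (Finset.mem_range.1 hj)).2]
    · intro i _ j _ hij
      rw [Function.onFun, Finset.disjoint_left]
      intro w hi hj
      obtain ⟨w', -, rfl⟩ := Finset.mem_image.1 hi
      obtain ⟨w'', -, he⟩ := Finset.mem_image.1 hj
      exact hij (List.append_inj_right' he rfl |> List.singleton_injective).symm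
    · simp

/-- The number of nodes of the tree of level `e` that encodes `i`. -/
def codeSize : ℕ → ℕ → ℕ
  | 0, i => i + 2
  | e + 1, i => 1 + ∑ j ∈ Finset.range (selfBase i),
      codeSize e (j * selfBase i + i / selfBase i ^ j % selfBase i)

theorem hasSize_leaf : HasSize d .leaf 1 :=
  hasSize_of_child (fun _ => 0) fun _ hj => absurd hj (Nat.not_lt_zero _)

theorem hasSize_code (e i : ℕ) : HasSize d (.code e i) (codeSize e i) := by
  induction e generalizing i with
  | zero =>
    have := hasSize_of_child (d := d) (τ := .code 0 i) (fun _ => 1) fun _ _ => hasSize_leaf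
    convert this using 1
    simp only [codeSize, arity, Finset.sum_const, Finset.card_range, smul_eq_mul]
    omega
  | succ e ih => exact hasSize_of_child (τ := .code (e + 1) i) _ fun j _ => ih _

/-- The number of nodes of the tree that unfolds the type of a node of the spine. -/
def spineSize (d : ℕ) (b : Bool) : ℕ → ℕ → ℕ
  | 0, m => codeSize d 0 + 1 + m
  | i + 1, m => codeSize d (i + 1) + 1 + spineSize d b i (leafCount b i) + m

theorem hasSize_spine (b : Bool) (i m : ℕ) : HasSize d (.spine b i m) (spineSize d b i m) := by
  induction i generalizing m with
  | zero =>
    have := hasSize_of_child (d := d) (τ := .spine b 0 m)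
      (fun j => Nat.casesOn j (codeSize d 0) fun _ => 1) (by
        rintro (- | j) -
        · exact hasSize_code _ _
        · exact hasSize_leaf)
    convert this using 1
    change _ = 1 + ∑ j ∈ Finset.range (m + 1), _
    rw [Finset.sum_range_succ']
    simp only [spineSize, Finset.sum_const, Finset.card_range, smul_eq_mul]
    change _ = 1 + (m * 1 + codeSize d 0)
    omega
  | succ i ih =>
    have := hasSize_of_child (d := d) (τ := .spine b (i + 1) m)
      (fun j => Nat.casesOn j (codeSize d (i + 1)) fun j =>
        Nat.casesOn j (spineSize d b i (leafCount b i)) fun _ => 1) (by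
        rintro (- | - | j) -
        · exact hasSize_code _ _
        · exact ih _
        · exact hasSize_leaf)
    convert this using 1
    change _ = 1 + ∑ j ∈ Finset.range (m + 1 + 1), _
    rw [Finset.sum_range_succ', Finset.sum_range_succ']
    simp only [spineSize, Finset.sum_const, Finset.card_range, smul_eq_mul]
    change _ = 1 + (m * 1 + spineSize d b i (leafCount b i) + codeSize d (i + 1))
    omega

theorem spineSize_add (b : Bool) (i m k : ℕ) :
    spineSize d b i (m + k) = spineSize d b i m + k := by
  cases i <;> simp only [spineSize] <;> omega

/-- The counts at positions `0` and `1` add up to `3` for both bits, so knowing `n` does not give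
the bit away. -/
theorem spineSize_bit (b b' : Bool) (i m : ℕ) :
    spineSize d b (i + 2) m = spineSize d b' (i + 2) m := by
  induction i generalizing m with
  | zero => cases b <;> cases b' <;> simp only [spineSize, leafCount, cond] <;> omega
  | succ i ih =>
    change _ + spineSize d b (i + 2) 1 + _ = _ + spineSize d b' (i + 2) 1 + _
    rw [ih]

theorem selfBase_le_of_lt {i k : ℕ} (hk : 0 < k) (h : i < k ^ k) : selfBase i ≤ k := by
  obtain ⟨k, rfl⟩ := Nat.exists_eq_succ_of_ne_zero hk.ne'
  exact Nat.succ_le_succ (Nat.find_min' _ h)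

theorem selfBase_mono : Monotone selfBase := fun _ j hij =>
  selfBase_le_of_lt (selfBase_pos j) (hij.trans_lt (lt_selfBase_pow j))

/-- A monotone upper bound for `codeSize`. -/
def codeBound : ℕ → ℕ → ℕ
  | 0, i => i + 2
  | e + 1, i => 1 + selfBase i * codeBound e (selfBase i ^ 2)

theorem codeBound_mono (e : ℕ) : Monotone (codeBound e) := by
  induction e with
  | zero => exact fun _ _ h => Nat.add_le_add_right h 2
  | succ e ih =>
    intro i j hij
    have h := selfBase_mono hij
    exact Nat.add_le_add_left (Nat.mul_le_mul h (ih (Nat.pow_le_pow_left h 2))) 1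

/-- Each child encodes a number below `selfBase i ^ 2`, as its index and its digit are both below
`selfBase i`. -/
theorem codeSize_le (e i : ℕ) : codeSize e i ≤ codeBound e i := by
  induction e generalizing i with
  | zero => exact le_rfl
  | succ e ih =>
    refine Nat.add_le_add_left ?_ 1
    have := Finset.sum_le_card_nsmul (Finset.range (selfBase i))
      (fun j => codeSize e (j * selfBase i + i / selfBase i ^ j % selfBase i))
      (codeBound e (selfBase i ^ 2)) fun j hj => (ih _).trans (codeBound_mono e ?_)
    · rwa [Finset.card_range, smul_eq_mul] at this
    · rw [Finset.mem_range] at hj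
      have h1 := Nat.mod_lt (i / selfBase i ^ j) (selfBase_pos i)
      have h2 := Nat.mul_le_mul_right (selfBase i) (Nat.succ_le_of_lt hj)
      rw [Nat.succ_mul] at h2
      rw [pow_two]
      omega

theorem spineSize_le (b : Bool) (i m : ℕ) :
    spineSize d b i m ≤ (i + 1) * (codeBound d i + 3) + m := by
  have hl : ∀ i, leafCount b i ≤ 2 := by
    rintro (- | - | i) <;> cases b <;> simp [leafCount]
  induction i generalizing m with
  | zero =>
    have := codeSize_le d 0
    simp only [spineSize]
    omega
  | succ i ih =>
    have h1 := codeSize_le d (i + 1)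
    have h2 := ih (leafCount b i)
    have h3 := hl i
    have h4 : (i + 1) * (codeBound d i + 3) ≤ (i + 1) * (codeBound d (i + 1) + 3) :=
      Nat.mul_le_mul_left _ (Nat.add_le_add_right (codeBound_mono d (Nat.le_succ i)) 3)
    rw [spineSize, Nat.succ_mul (i + 1)]
    omega

/-- The height of the tree that unfolds a type. -/
def height (d : ℕ) : NodeType → ℕ
  | .leaf => 0
  | .code e _ => e + 1
  | .spine _ i _ => i + d + 2

theorem height_child_lt {τ : NodeType} {j : ℕ} (hj : j < arity τ) :
    height d (child d τ j) < height d τ := by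
  rcases τ with - | ⟨- | e, i⟩ | ⟨b, - | i, m⟩
  · exact absurd hj (Nat.not_lt_zero _)
  · exact Nat.succ_pos _
  · exact Nat.lt_succ_self _
  · rcases j with - | j <;> simp only [child, height] <;> omega
  · rcases j with - | - | j <;> simp only [child, height] <;> omega

theorem length_add_height_le {τ : NodeType} {w : List ℕ} (hw : IsAddress d τ w) :
    w.length + height d (typeAt d τ w) ≤ height d τ := by
  induction w with
  | nil => simp [typeAt]
  | cons j w ih =>
    have h1 := ih hw.2
    have h2 := height_child_lt (d := d) hw.1
    rw [List.length_cons, typeAt]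
    omega

theorem edist_le_height {τ : NodeType} (u v : Vertex d τ) :
    (treeGraph d τ).edist u v ≤ (2 * height d τ : ℕ) := by
  have key : ∀ v : Vertex d τ, (treeGraph d τ).edist (root d τ) v ≤ (height d τ : ℕ) := fun v =>
    (edist_root_le v).trans (Nat.cast_le.2 ((Nat.le_add_right _ _).trans
      (length_add_height_le v.2)))
  calc (treeGraph d τ).edist u v
      ≤ (treeGraph d τ).edist u (root d τ) + (treeGraph d τ).edist (root d τ) v :=
        SimpleGraph.edist_triangle
    _ ≤ (height d τ : ℕ) + (height d τ : ℕ) := by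
      gcongr
      · rw [SimpleGraph.edist_comm]
        exact key u
      · exact key v
    _ = (2 * height d τ : ℕ) := by push_cast; rw [two_mul]

end Size

/-! ### The hidden bit is invisible from the start of the spine -/

section HiddenBit

variable {d l q : ℕ} {b b' : Bool}

/-- The same type with another hidden bit. -/
def setBit (b : Bool) : NodeType → NodeType
  | .spine _ i m => .spine b i m
  | τ => τ

theorem arity_setBit (b : Bool) (τ : NodeType) : arity (setBit b τ) = arity τ := by
  rcases τ with - | _ | ⟨_, - | i, m⟩ <;> rfl

theorem typeAt_setBit {w : List ℕ} (hw : w.length ≤ l) :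
    typeAt d (.spine b' (l + 2) q) w = setBit b' (typeAt d (.spine b (l + 2) q) w) := by
  induction w with
  | nil => rfl
  | cons j w ih =>
    rw [List.length_cons] at hw
    rw [typeAt, typeAt, ih (by omega)]
    rcases ht : typeAt d (.spine b (l + 2) q) w with - | ⟨- | e, i⟩ | ⟨b'', i, m⟩
    · rfl
    · rfl
    · rfl
    · obtain ⟨-, hlen, -⟩ := typeAt_eq_spine ht
      -- Below position `3` comes position `2` or more, where the leaf count does not depend on the
      -- bit.
      obtain ⟨i, rfl⟩ : ∃ i', i = i' + 3 := ⟨i - 3, by omega⟩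
      rcases j with - | - | j <;> rfl

/-- Position `1` has depth `l + 1`, so the leaves that reveal the bit first appear at depth `l + 2`.
-/
theorem isAddress_of_isAddress {w : List ℕ} (hw : w.length ≤ l + 1)
    (h : IsAddress d (.spine b (l + 2) q) w) : IsAddress d (.spine b' (l + 2) q) w := by
  induction w with
  | nil => trivial
  | cons j w ih =>
    rw [List.length_cons] at hw
    refine ⟨?_, ih (by omega) h.2⟩
    rw [typeAt_setBit (b := b) (by omega), arity_setBit]
    exact h.1

end HiddenBit

/-! ### The problem and its complexity -/

section Problem

variable {c d : ℕ} {R : ℕ → ℕ → Prop} {G : SimpleGraph V}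

theorem Good.of_iso {Λ : Type} {X Y : View Λ} (e : X.graph ≃g Y.graph)
    (he : e X.center = Y.center) : Good d R X.graph X.center = Good d R Y.graph Y.center :=
  propext (he ▸ good_map_iff e.injective (nbhdOntoWithin_iso e _ _))

/-- The checker that accepts the trees that unfold the type of a start of a spine, where `R` says
which lengths of the spine and numbers of leaves at the start are allowed. -/
def treeChecker (c d : ℕ) (R : ℕ → ℕ → Prop) : LocalChecker (Fin c) (d + 4) where
  run W := Good d R W.graph W.center
  run_eq_of_iso _ _ := fun ⟨e, _, he⟩ => Good.of_iso e he

theorem treeChecker_accepts_iff {col : V → Fin c} :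
    LocalChecker.Accepts (treeChecker c d R) G col ↔ ∀ v, Good d R G v :=
  forall_congr' fun _ => good_map_iff Subtype.val_injective
    (nbhdOntoWithin_viewAt_center (Nat.lt_succ_self _))

/-- The problem of finding the bit hidden at the end of the spine: all nodes have the same output,
which is the hidden bit. -/
def hiddenBit (c d : ℕ) (R : ℕ → ℕ → Prop) : GeneralizedLCL c (d + 4) where
  Out := Bool
  finite_out := inferInstance
  checker :=
    { run := fun W => Good d R W.graph W.center ∧
        (∀ x, W.graph.Adj W.center x → (W.label x).2 = (W.label W.center).2) ∧
        ∀ b, IsEnd d W.graph b W.center → (W.label W.center).2 = b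
      run_eq_of_iso := by
        rintro X Y ⟨e, hl, he⟩
        have hnbr := nbhdOntoWithin_iso e
        refine congrArg₂ And (Good.of_iso e he) (propext (and_congr ?_ (forall_congr' fun b =>
          imp_congr ?_ ?_)))
        · rw [← he]
          exact (nbhdOnto_iso e _).forall_iff fun x _ => by rw [hl, hl]
        · rw [← he]
          exact isEnd_map_iff e.injective (hnbr _ _)
        · rw [← he, hl] }

theorem hiddenBit_isSolution_iff {col : V → Fin c} {out : V → Bool} :
    (hiddenBit c d R).IsSolution G col out ↔ ∀ v, Good d R G v ∧
      (∀ x, G.Adj v x → out x = out v) ∧ ∀ b, IsEnd d G b v → out v = b := by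
  refine forall_congr' fun v => ?_
  have hnbr : ∀ m < d + 4, NbhdOntoWithin
      (viewAt (d + 4) G (fun v => (col v, out v)) v).graph G Subtype.val m
      (viewAt (d + 4) G (fun v => (col v, out v)) v).center :=
    fun m hm => nbhdOntoWithin_viewAt_center hm
  exact and_congr (good_map_iff Subtype.val_injective (hnbr _ (by omega)))
    (and_congr ((hnbr 0 (by omega)).nbhdOnto.forall_iff fun _ _ => Iff.rfl)
      (forall_congr' fun _ => imp_congr
        (isEnd_map_iff Subtype.val_injective (hnbr _ (by omega))) Iff.rfl))

theorem exists_iso_of_good [Finite V] (hG : G.IsTree) (h : ∀ v, Good d R G v) :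
    ∃ b l q, 1 ≤ q ∧ R (l + 2) q ∧ Nonempty (treeGraph d (.spine b (l + 2) q) ≃g G) := by
  have := hG.connected.nonempty
  obtain ⟨v, b, l, q, hR, hq, hr⟩ := exists_realizes_of_good h
  exact ⟨b, l, q, hq, hR, nonempty_iso_of_realizes hG hr⟩

theorem isEnd_iff_of_iso {b b' : Bool} {l q : ℕ} (e : treeGraph d (.spine b (l + 2) q) ≃g G)
    (hq : 1 ≤ q) : (∃ v, IsEnd d G b' v) ↔ b' = b := by
  constructor
  · rintro ⟨v, hv⟩
    obtain ⟨w, rfl⟩ := e.surjective v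
    exact ((isEnd_map_iff e.injective (nbhdOntoWithin_iso e _ _)).2 hv).eq_bit hq
  · rintro rfl
    obtain ⟨v, hv⟩ := exists_isEnd (d := d) (l := l) (b := b') hq
    exact ⟨e v, (isEnd_map_iff e.injective (nbhdOntoWithin_iso e _ _)).1 hv⟩

theorem hiddenBit_isSolution_const {b : Bool} {l q : ℕ} {col : V → Fin c}
    (e : treeGraph d (.spine b (l + 2) q) ≃g G) (hq : 1 ≤ q) (h : ∀ v, Good d R G v) :
    (hiddenBit c d R).IsSolution G col fun _ => b :=
  hiddenBit_isSolution_iff.2 fun v => ⟨h v, fun _ _ => rfl, fun _ hb' =>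
    ((isEnd_iff_of_iso e hq).1 ⟨v, hb'⟩).symm⟩

theorem hiddenBit_solution_eq {b : Bool} {l q : ℕ} {col : V → Fin c} {out : V → Bool}
    (hG : G.Connected) (e : treeGraph d (.spine b (l + 2) q) ≃g G) (hq : 1 ≤ q)
    (h : (hiddenBit c d R).IsSolution G col out) (v : V) : out v = b := by
  rw [hiddenBit_isSolution_iff] at h
  obtain ⟨u, hu⟩ := (isEnd_iff_of_iso e hq).2 rfl
  rw [← (h u).2.2 b hu]
  obtain ⟨p⟩ := hG u v
  clear hu
  induction p with
  | nil => rfl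
  | cons huw _ ih => rw [ih, (h _).2.1 _ huw]

theorem treeChecker_accepts_iff_exists_solution [Finite V] {col : V → Fin c} (hG : G.IsTree) :
    LocalChecker.Accepts (treeChecker c d R) G col ↔
      ∃ out : V → Bool, (hiddenBit c d R).IsSolution G col out := by
  rw [treeChecker_accepts_iff]
  constructor
  · intro h
    obtain ⟨b, l, q, hq, -, ⟨e⟩⟩ := exists_iso_of_good hG h
    exact ⟨_, hiddenBit_isSolution_const e hq h⟩
  · rintro ⟨out, h⟩ v
    exact (hiddenBit_isSolution_iff.1 h v).1

theorem card_vertex (b : Bool) (l q : ℕ) [Fintype (Vertex d (.spine b (l + 2) q))] :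
    Fintype.card (Vertex d (.spine b (l + 2) q)) = spineSize d true (l + 2) q := by
  obtain ⟨F, hF, hs⟩ := hasSize_spine (d := d) b (l + 2) q
  rw [Fintype.card_of_subtype F hF, hs, spineSize_bit b true]

/-! ### Upper and lower bounds on the number of rounds -/

theorem edist_map_le {A B : Type} {H : SimpleGraph A} {G : SimpleGraph B} (e : H →g G) (u v : A) :
    G.edist (e u) (e v) ≤ H.edist u v := by
  by_cases h : H.edist u v = ⊤
  · rw [h]
    exact le_top
  · obtain ⟨p, hp⟩ := SimpleGraph.exists_walk_of_edist_ne_top h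
    rw [← hp, ← SimpleGraph.Walk.length_map e p]
    exact SimpleGraph.edist_le _

open Classical in
/-- The algorithm that looks for an end of the spine that hides the bit `true`. -/
noncomputable def findBit (c d T : ℕ) : LocalAlgorithm (Fin c × ℕ) Bool T where
  run W := decide (∃ u, IsEnd d W.graph true u)
  run_eq_of_iso := by
    rintro X Y ⟨e, -, -⟩
    refine decide_eq_decide.2 ⟨?_, ?_⟩
    · rintro ⟨u, hu⟩
      exact ⟨e u, (isEnd_map_iff e.injective (nbhdOntoWithin_iso e _ _)).1 hu⟩
    · rintro ⟨u, hu⟩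
      exact ⟨e.symm u, (isEnd_map_iff e.symm.injective (nbhdOntoWithin_iso e.symm _ _)).1 hu⟩

/-- The term `2 * (l + 2 + d + 2)` is twice the height and bounds the diameter; the extra `d + 2`
lets every node recognize an end anywhere in the tree. If `R` allows no tree of size `n`, the
hypothesis is vacuous. -/
theorem hiddenBit_solvable {κ n T : ℕ}
    (hT : ∀ l q, 1 ≤ q → R (l + 2) q → spineSize d true (l + 2) q = n →
      2 * (l + 2 + d + 2) + (d + 2) < T) : (hiddenBit c d R).SolvableInRounds κ n T := by
  refine ⟨findBit c d T, fun V _ G col ident hcard ⟨hG, out, hout⟩ _ _ => ?_⟩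
  have hgood : ∀ v, Good d R G v := fun v => (hiddenBit_isSolution_iff.1 hout v).1
  obtain ⟨b, l, q, hq, hR, ⟨e⟩⟩ := exists_iso_of_good hG hgood
  have : Fintype (Vertex d (.spine b (l + 2) q)) := Fintype.ofEquiv V e.toEquiv.symm
  have hlT := hT l q hq hR (by rw [← card_vertex b, ← hcard]; exact Fintype.card_congr e.toEquiv)
  have hball : ∀ u v, G.edist u v + ((d + 2 : ℕ) : ℕ∞) < T := by
    intro u v
    obtain ⟨u, rfl⟩ := e.surjective u
    obtain ⟨v, rfl⟩ := e.surjective v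
    calc G.edist (e u) (e v) + ((d + 2 : ℕ) : ℕ∞)
        ≤ (2 * height d (.spine b (l + 2) q) : ℕ) + ((d + 2 : ℕ) : ℕ∞) := by
          gcongr
          exact (edist_map_le e.toHom u v).trans (edist_le_height u v)
      _ < T := by exact_mod_cast hlT
  have hout : (findBit c d T).output G (fun v => (col v, ident v)) = fun _ => b := by
    funext v
    have key : (∃ u, IsEnd d (viewAt T G (fun v => (col v, ident v)) v).graph true u) ↔
        true = b := by
      rw [← isEnd_iff_of_iso e hq]
      constructor
      · rintro ⟨u, hu⟩
        exact ⟨u.1, (isEnd_map_iff Subtype.val_injective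
          (nbhdOntoWithin_viewAt _ u (hball v u.1))).1 hu⟩
      · rintro ⟨u, hu⟩
        exact ⟨⟨u, le_self_add.trans (hball v u).le⟩, (isEnd_map_iff Subtype.val_injective
          (nbhdOntoWithin_viewAt _ _ (hball v u))).2 hu⟩
    have hb : decide (true = b) = b := by cases b <;> simp
    exact (decide_eq_decide.2 key).trans hb
  exact hout ▸ hiddenBit_isSolution_const e hq hgood

/-- For `T ≤ l + 1` the two trees look the same from the root within radius `T`. Giving equal
identifiers to the common part forces equal outputs at the roots, while the bits differ. -/
theorem le_of_hiddenBit_solvable {κ n T l q : ℕ} (hc : 1 ≤ c) (hκ : 1 ≤ κ) (hq : 1 ≤ q)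
    (hR : R (l + 2) q) (hn : spineSize d true (l + 2) q = n)
    (h : (hiddenBit c d R).SolvableInRounds κ n T) : l + 2 ≤ T := by
  by_contra! hlt
  obtain ⟨alg, halg⟩ := h
  have hfin : ∀ b, Finite (Vertex d (.spine b (l + 2) q)) := by
    intro b
    obtain ⟨F, hF, -⟩ := hasSize_spine (d := d) b (l + 2) q
    exact Finite.of_injective (β := F) (fun w => ⟨w.1, (hF _).2 w.2⟩) fun w w' h =>
      Subtype.ext (congrArg (fun x : F => x.1) h)
  have hfin' : ∀ b, Fintype (Vertex d (.spine b (l + 2) q)) := fun b => Fintype.ofFinite _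
  have hcard : ∀ b, Fintype.card (Vertex d (.spine b (l + 2) q)) = n := fun b =>
    (card_vertex b l q).trans hn
  have hroot : ∀ (b : Bool) (ident : Vertex d (.spine b (l + 2) q) → ℕ), Function.Injective ident →
      (∀ v, ident v ∈ Finset.Icc 1 n) →
      alg.output (treeGraph d (.spine b (l + 2) q)) (fun v => ((⟨0, hc⟩ : Fin c), ident v))
        (root d (.spine b (l + 2) q)) = b := by
    intro b ident hinj hmem
    have hgood : ∀ v, Good d R (treeGraph d (.spine b (l + 2) q)) v := good_treeGraph hq hR
    refine hiddenBit_solution_eq (R := R) (treeGraph_connected _ _) SimpleGraph.Iso.refl hq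
      (halg _ _ (fun _ => ⟨0, hc⟩) ident (hcard b) ⟨treeGraph_isTree _ _, _,
        hiddenBit_isSolution_const SimpleGraph.Iso.refl hq hgood⟩ hinj fun v => ?_) _
    obtain ⟨h1, h2⟩ := Finset.mem_Icc.1 (hmem v)
    exact ⟨h1, h2.trans (Nat.le_self_pow (by omega) n)⟩
  have hIcc : ∀ b, Fintype.card (Vertex d (.spine b (l + 2) q)) = (Finset.Icc 1 n).card := fun b =>
    (hcard b).trans (by simp)
  obtain ⟨id₁⟩ : Nonempty (Vertex d (.spine true (l + 2) q) ≃ Finset.Icc 1 n) := by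
    rw [← Fintype.card_eq, Fintype.card_coe]
    exact hIcc true
  let trans : ∀ b b' : Bool, (w : Vertex d (.spine b (l + 2) q)) → w.1.length ≤ T →
      Vertex d (.spine b' (l + 2) q) := fun b b' w hw =>
    ⟨w.1, isAddress_of_isAddress (hw.trans (Nat.le_of_lt_succ hlt)) w.2⟩
  -- Copy the identifiers of the other tree near the root; the value `0` elsewhere is never used.
  let f : Vertex d (.spine false (l + 2) q) → ℕ := fun w =>
    if hw : w.1.length ≤ T then id₁ (trans false true w hw) else 0
  have hf : ∀ w (hw : w.1.length ≤ T), f w = id₁ (trans false true w hw) := fun w hw => dif_pos hw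
  -- Equal sizes allow the copied identifiers to be extended to a bijection with `{1, …, n}`.
  obtain ⟨id₀, hid₀⟩ := Set.MapsTo.exists_equiv_extend_of_card_eq (hIcc false)
    (s := {w | w.1.length ≤ T}) (f := f) (fun w hw => by
      rw [hf w hw]
      exact (id₁ _).2) (fun w hw w' hw' he => by
      rw [hf w hw, hf w' hw'] at he
      exact Subtype.ext (Subtype.mk.inj (id₁.injective (Subtype.ext he))))
  have h0 := hroot false (fun v => id₀ v) (Subtype.val_injective.comp id₀.injective)
    fun v => (id₀ v).2
  have h1 := hroot true (fun v => id₁ v) (Subtype.val_injective.comp id₁.injective)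
    fun v => (id₁ v).2
  refine Bool.false_ne_true (h0.symm.trans (Eq.trans (alg.run_eq_of_iso _ _ ?_) h1))
  have hlen : ∀ b (w : Vertex d (.spine b (l + 2) q)),
      (treeGraph d (.spine b (l + 2) q)).edist (root d _) w ≤ T ↔ w.1.length ≤ T := fun b w =>
    ⟨length_le_of_edist_root_le, fun h => (edist_root_le w).trans (Nat.cast_le.2 h)⟩
  have hlen' : ∀ b (w : Vertex d (.spine b (l + 2) q)),
      (treeGraph d (.spine b (l + 2) q)).edist (root d _) w < T ↔ w.1.length < T := by
    intro b w
    rcases T with - | T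
    · simp
    · have : ∀ x : ℕ∞, x < ((T + 1 : ℕ) : ℕ∞) ↔ x ≤ T := fun x => by
        rw [Nat.cast_add, Nat.cast_one, ENat.lt_natCast_add_one_iff]
      rw [this, Nat.lt_succ_iff]
      exact ⟨length_le_of_edist_root_le, fun h => (edist_root_le w).trans (Nat.cast_le.2 h)⟩
  -- The isomorphism of views is the identity on addresses.
  refine ⟨⟨⟨fun w => ⟨trans false true w.1 ((hlen _ _).1 w.2),
      (hlen true _).2 ((hlen false w.1).1 w.2)⟩,
    fun w => ⟨trans true false w.1 ((hlen _ _).1 w.2),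
      (hlen false _).2 ((hlen true w.1).1 w.2)⟩,
    fun w => rfl, fun w => rfl⟩, ?_⟩, fun w => ?_, rfl⟩
  · intro w w'
    refine and_congr Iff.rfl (or_congr ?_ ?_)
    · exact (hlen' _ _).trans (hlen' false w.1).symm
    · exact (hlen' _ _).trans (hlen' false w'.1).symm
  · have hw := (hlen _ _).1 w.2
    have := hid₀ w.1 hw
    rw [hf _ hw] at this
    exact Prod.ext rfl this.symm

end Problem

/-- A problem with complexity between `ell n` and a linear function of it for all `n` in `S`, and
without instances of size `n` for other `n`. -/
theorem exists_hasComplexity (c d : ℕ) (hc : 1 ≤ c) (S : ℕ → Prop) (ell : ℕ → ℕ)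
    (hS : ∀ n, S n → (ell n + 3) * (codeBound d (ell n + 2) + 3) + 1 ≤ n) :
    ∃ (L : LocalChecker (Fin c) (d + 4)) (P : GeneralizedLCL c (d + 4)),
      (∀ (V : Type) [Fintype V] (G : SimpleGraph V) (col : V → Fin c), G.IsTree →
        (L.Accepts G col ↔ ∃ out : V → P.Out, P.IsSolution G col out)) ∧
      ∀ κ : ℕ, 1 ≤ κ → ∃ t : ℕ → ℕ, P.HasComplexity κ t ∧
        (∀ n, S n → ell n + 2 ≤ t n ∧ t n ≤ 2 * ell n + 3 * d + 11) ∧ ∀ n, ¬S n → t n = 0 := by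
  -- The start computes the size of the tree from its own position and leaf count, so the spine
  -- length can be tied to `n`.
  let R : ℕ → ℕ → Prop := fun i q => S (spineSize d true i q) ∧ i = ell (spineSize d true i q) + 2
  refine ⟨treeChecker c d R, hiddenBit c d R, fun V _ G col hG =>
    treeChecker_accepts_iff_exists_solution hG, fun κ hκ => ?_⟩
  have hub : ∀ n, (hiddenBit c d R).SolvableInRounds κ n (2 * ell n + 3 * d + 11) := by
    refine fun n => hiddenBit_solvable ?_
    rintro l q - ⟨-, hl⟩ rfl
    omega
  refine ⟨fun n => sInf {T | (hiddenBit c d R).SolvableInRounds κ n T},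
    fun n => ⟨Nat.sInf_mem ⟨_, hub n⟩, fun T hT => Nat.sInf_le hT⟩,
    fun n hn => ⟨?_, Nat.sInf_le (hub n)⟩, fun n hn => ?_⟩
  · have h0 := spineSize_le (d := d) true (ell n + 2) 0
    have h1 := hS n hn
    rw [show ell n + 2 + 1 = ell n + 3 from rfl] at h0
    -- The spare nodes become leaves at the start; at least one is left, as a spine node needs a
    -- leaf.
    obtain ⟨q, hq⟩ := Nat.exists_eq_add_of_le (show spineSize d true (ell n + 2) 0 + 1 ≤ n by omega)
    have hq' : spineSize d true (ell n + 2) (q + 1) = n := by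
      rw [← zero_add (q + 1), spineSize_add]
      omega
    exact le_of_hiddenBit_solvable hc hκ (Nat.le_add_left 1 q)
      (show R (ell n + 2) (q + 1) from by
        change S _ ∧ _ = ell _ + 2
        rw [hq']
        exact ⟨hn, rfl⟩) hq'
      (Nat.sInf_mem (s := {T | (hiddenBit c d R).SolvableInRounds κ n T}) ⟨_, hub n⟩)
  -- There are no instances of size `n`, so radius `0` works.
  · refine Nat.le_zero.1 (Nat.sInf_le (hiddenBit_solvable ?_))
    rintro l q - ⟨hq, -⟩ rfl
    exact absurd hq hn

/-! ### Iterated logarithms -/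

theorem tendsto_iterLog_atTop (m : ℕ) : Tendsto (Real.log^[m]) atTop atTop :=
  Real.tendsto_log_atTop.iterate m

theorem eventually_iterLog_mono (m : ℕ) :
    ∀ᶠ x in atTop, ∀ y ≥ x, Real.log^[m] x ≤ Real.log^[m] y := by
  induction m with
  | zero => exact Eventually.of_forall fun _ _ h => h
  | succ m ih =>
    filter_upwards [ih, (tendsto_iterLog_atTop m).eventually_gt_atTop 0] with x hx h0 y hy
    rw [Function.iterate_succ_apply', Function.iterate_succ_apply']
    exact Real.log_le_log h0 (hx y hy)

theorem eventually_iterLog_sq_le (m : ℕ) :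
    ∀ᶠ x : ℝ in atTop, Real.log^[m + 1] (x ^ 2) ≤ 2 * Real.log^[m + 1] x := by
  induction m with
  | zero => exact Eventually.of_forall fun x => by simp [Real.log_pow]
  | succ m ih =>
    have hsq : Tendsto (fun x : ℝ => x ^ 2) atTop atTop := tendsto_pow_atTop two_ne_zero
    filter_upwards [ih, ((tendsto_iterLog_atTop (m + 1)).comp hsq).eventually_gt_atTop 0,
      (tendsto_iterLog_atTop (m + 1)).eventually_ge_atTop 2] with x hx h0 h2
    rw [Function.iterate_succ_apply' _ (m + 1), Function.iterate_succ_apply' _ (m + 1)]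
    calc Real.log (Real.log^[m + 1] (x ^ 2)) ≤ Real.log (2 * Real.log^[m + 1] x) :=
          Real.log_le_log h0 hx
      _ = Real.log 2 + Real.log (Real.log^[m + 1] x) :=
          Real.log_mul two_ne_zero (by linarith)
      _ ≤ 2 * Real.log (Real.log^[m + 1] x) := by
          have := Real.log_le_log two_pos h2
          linarith

theorem eventually_iterLog_succ_le (m : ℕ) :
    ∀ᶠ x : ℝ in atTop, Real.log^[m + 1] x ≤ Real.log^[m] x := by
  filter_upwards [(tendsto_iterLog_atTop m).eventually_ge_atTop 0] with x hx
  rw [Function.iterate_succ_apply']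
  exact Real.log_le_self hx

theorem eventually_iterLog_le_log (m : ℕ) :
    ∀ᶠ x : ℝ in atTop, Real.log^[m + 1] x ≤ Real.log x := by
  induction m with
  | zero => exact Eventually.of_forall fun x => le_rfl
  | succ m ih =>
    filter_upwards [ih, eventually_iterLog_succ_le (m + 1)] with x h1 h2 using h2.trans h1

theorem eventually_continuousAt_iterLog (m : ℕ) : ∀ᶠ x in atTop, ContinuousAt (Real.log^[m]) x := by
  induction m with
  | zero => exact Eventually.of_forall fun x => continuousAt_id
  | succ m ih =>
    filter_upwards [ih, (tendsto_iterLog_atTop m).eventually_gt_atTop 0] with x hx h0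
    rw [Function.iterate_succ']
    exact (Real.continuousAt_log h0.ne').comp hx

theorem tendsto_divIterLog_atTop (m : ℕ) : Tendsto (divIterLog (m + 1)) atTop atTop := by
  have h1 : Tendsto (fun x : ℝ => x / Real.log x) atTop atTop := by
    have h2 := Real.isLittleO_log_id_atTop.tendsto_div_nhds_zero
    have h3 : Tendsto (fun x : ℝ => Real.log x / id x) atTop (nhdsWithin 0 (Set.Ioi 0)) := by
      refine tendsto_nhdsWithin_iff.2 ⟨h2, ?_⟩
      filter_upwards [eventually_gt_atTop 1] with x hx
      exact div_pos (Real.log_pos hx) (zero_lt_one.trans hx)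
    refine h3.inv_tendsto_nhdsGT_zero.congr fun x => ?_
    simp
  refine tendsto_atTop_mono' _ ?_ h1
  filter_upwards [eventually_iterLog_le_log m, eventually_ge_atTop 0,
    (tendsto_iterLog_atTop (m + 1)).eventually_gt_atTop 0] with x h1 h2 h3
  exact div_le_div_of_nonneg_left h2 h3 h1

/-- The intermediate value theorem gives a preimage `x ≥ y` of `y`, and then `x = y * log^(m+1) x ≥
y * log^(m+1) y`. Divergence bounds the set of preimages, so that the supremum is meaningful. -/
theorem eventually_mul_iterLog_le_invDivIterLog (m : ℕ) :
    ∀ᶠ y : ℝ in atTop, y * Real.log^[m + 1] y ≤ invDivIterLog (m + 4) y := by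
  filter_upwards [eventually_forall_ge_atTop.2 (eventually_continuousAt_iterLog (m + 1)),
    eventually_iterLog_mono (m + 1), eventually_ge_atTop 0,
    (tendsto_iterLog_atTop (m + 1)).eventually_ge_atTop 1] with y hc hm h0 h1
  obtain ⟨z, hz⟩ := eventually_atTop.1
    ((tendsto_divIterLog_atTop m).eventually_gt_atTop y)
  have hpos : ∀ x ≥ y, 0 < Real.log^[m + 1] x := fun x hx =>
    zero_lt_one.trans_le (h1.trans (hm x hx))
  obtain ⟨x, ⟨hx, -⟩, hxy⟩ := intermediate_value_Icc (le_max_left y z)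
    (f := divIterLog (m + 1)) (fun x hx => ((continuousAt_id.div (hc x hx.1)
      (hpos x hx.1).ne')).continuousWithinAt) (show y ∈ Set.Icc _ _ from
      ⟨div_le_self h0 h1, (hz _ (le_max_right y z)).le⟩)
  have hbdd : BddAbove {x | divIterLog (m + 1) x = y} :=
    ⟨z, fun x hx => le_of_not_gt fun h => (hz x h.le).ne' hx⟩
  refine le_trans ?_ (le_csSup hbdd hxy)
  have hxe : x = y * Real.log^[m + 1] x := (div_eq_iff (hpos x hx).ne').1 hxy
  exact (mul_le_mul_of_nonneg_left (hm x hx) h0).trans_eq hxe.symm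

/-! ### Growth of the codes -/

theorem tendsto_selfBase_atTop : Tendsto selfBase atTop atTop := by
  refine tendsto_atTop_atTop.2 fun k => ⟨k ^ k, fun i hi => ?_⟩
  by_contra! h
  have h1 := lt_selfBase_pow i
  have h2 : selfBase i ^ selfBase i ≤ k ^ k :=
    (Nat.pow_le_pow_left h.le _).trans (Nat.pow_le_pow_right (by omega) h.le)
  omega

/-- By minimality `(k - 1) ^ (k - 1) ≤ i` for `k = selfBase i`. Passing from `k - 1` to `k` costs at
most a factor `2` in each of `k` and `log k`. -/
theorem eventually_selfBase_mul_log_le :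
    ∀ᶠ i : ℕ in atTop, (selfBase i : ℝ) * Real.log (selfBase i) ≤ 4 * Real.log i := by
  filter_upwards [tendsto_selfBase_atTop.eventually_ge_atTop 3] with i hi
  obtain ⟨k, hk⟩ := Nat.exists_eq_add_of_le' hi
  have h1 : (k + 2) ^ (k + 2) ≤ i := by
    by_contra! h
    have := selfBase_le_of_lt (Nat.succ_pos _) h
    omega
  have h2 : ((k + 2 : ℕ) : ℝ) * Real.log ((k + 2 : ℕ) : ℝ) ≤ Real.log i := by
    rw [← Real.log_pow]
    exact Real.log_le_log (by positivity) (by exact_mod_cast h1)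
  have h3 : Real.log ((k + 3 : ℕ) : ℝ) ≤ 2 * Real.log ((k + 2 : ℕ) : ℝ) := by
    have : 2 * Real.log ((k + 2 : ℕ) : ℝ) = Real.log (((k + 2 : ℕ) : ℝ) ^ 2) := by
      rw [Real.log_pow]
      norm_num
    rw [this]
    refine Real.log_le_log (by positivity) ?_
    exact_mod_cast (show k + 3 ≤ (k + 2) ^ 2 by nlinarith)
  have h4 : 0 ≤ Real.log ((k + 3 : ℕ) : ℝ) := Real.log_natCast_nonneg _
  have h5 : ((k + 3 : ℕ) : ℝ) ≤ 2 * ((k + 2 : ℕ) : ℝ) := by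
    push_cast
    have : (0 : ℝ) ≤ k := Nat.cast_nonneg k
    linarith
  rw [hk]
  calc ((k + 3 : ℕ) : ℝ) * Real.log ((k + 3 : ℕ) : ℝ)
      ≤ (2 * ((k + 2 : ℕ) : ℝ)) * (2 * Real.log ((k + 2 : ℕ) : ℝ)) :=
        mul_le_mul h5 h3 h4 (by positivity)
    _ ≤ 4 * Real.log i := by linarith

theorem tendsto_log_selfBase : Tendsto (fun i => Real.log (selfBase i)) atTop atTop :=
  Real.tendsto_log_atTop.comp (tendsto_natCast_atTop_atTop.comp tendsto_selfBase_atTop)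

theorem eventually_selfBase_le_log : ∀ᶠ i : ℕ in atTop, (selfBase i : ℝ) ≤ Real.log i := by
  filter_upwards [eventually_selfBase_mul_log_le,
    tendsto_log_selfBase.eventually_ge_atTop 4] with i h1 h2
  have h3 := mul_le_mul_of_nonneg_left h2 (Nat.cast_nonneg (α := ℝ) (selfBase i))
  linarith

theorem isBigO_selfBase_mul_log :
    (fun i : ℕ => (selfBase i : ℝ) * Real.log (selfBase i)) =O[atTop]
      fun i : ℕ => Real.log i := by
  refine IsBigO.of_bound 4 ?_
  filter_upwards [eventually_selfBase_mul_log_le] with i hi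
  rwa [Real.norm_of_nonneg (mul_nonneg (Nat.cast_nonneg _) (Real.log_natCast_nonneg _)),
    Real.norm_of_nonneg (Real.log_natCast_nonneg _)]

theorem tendsto_selfBase_sq : Tendsto (fun i => selfBase i ^ 2) atTop atTop :=
  (tendsto_pow_atTop two_ne_zero).comp tendsto_selfBase_atTop

theorem isBigO_codeBound_succ {e : ℕ} {g : ℕ → ℝ} (hg : Tendsto g atTop atTop)
    (h : (fun i : ℕ => (selfBase i : ℝ) * codeBound e (selfBase i ^ 2)) =O[atTop] g) :
    (fun i : ℕ => (codeBound (e + 1) i : ℝ)) =O[atTop] g := by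
  have h1 : (fun _ : ℕ => (1 : ℝ)) =O[atTop] g :=
    (isLittleO_const_left.2 (Or.inr (tendsto_norm_atTop_atTop.comp hg))).isBigO
  refine (h1.add h).congr_left fun i => ?_
  simp only [codeBound]
  push_cast
  ring

theorem tendsto_log_mul_iterLog (m : ℕ) :
    Tendsto (fun i : ℕ => Real.log i * Real.log^[m] i) atTop atTop :=
  (Real.tendsto_log_atTop.comp tendsto_natCast_atTop_atTop).atTop_mul_atTop₀
    ((tendsto_iterLog_atTop m).comp tendsto_natCast_atTop_atTop)

/-- Level `0` is linear, so level `1` costs about `k * k ^ 2` with `k ≤ log i`. -/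
theorem isBigO_codeBound_one :
    (fun i : ℕ => (codeBound 1 i : ℝ)) =O[atTop] fun i : ℕ => Real.log i ^ 3 := by
  refine isBigO_codeBound_succ ((tendsto_pow_atTop three_ne_zero).comp
    (Real.tendsto_log_atTop.comp tendsto_natCast_atTop_atTop)) (IsBigO.of_bound 3 ?_)
  filter_upwards [eventually_selfBase_le_log] with i hi
  have h1 : (1 : ℝ) ≤ selfBase i := by exact_mod_cast selfBase_pos i
  rw [Real.norm_of_nonneg (by positivity),
    Real.norm_of_nonneg (pow_nonneg (Real.log_natCast_nonneg _) 3)]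
  have h2 : (selfBase i : ℝ) ^ 3 ≤ Real.log i ^ 3 := pow_le_pow_left₀ (by linarith) hi 3
  simp only [codeBound]
  push_cast
  nlinarith [sq_nonneg ((selfBase i : ℝ) - 1), mul_pos (zero_lt_one.trans_le h1)
    (zero_lt_one.trans_le h1)]

/-- With `k = selfBase i`, the recursion gives `k * log k * log^(e+1) (k ^ 2)`. Here `k * log k =
O(log i)`, and `k ≤ log i` turns the last factor into one more iterated logarithm of `i`. At level
`2`, the cubic bound for level `1` gives `(k * log k) * log² k`, with `log² k = O(k)`. -/
theorem isBigO_codeBound (e : ℕ) :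
    (fun i : ℕ => (codeBound (e + 2) i : ℝ)) =O[atTop]
      fun i : ℕ => Real.log i * Real.log^[e + 1] i := by
  induction e with
  | zero =>
    refine isBigO_codeBound_succ (tendsto_log_mul_iterLog 1) ?_
    have h1 : (fun i : ℕ => (codeBound 1 (selfBase i ^ 2) : ℝ)) =O[atTop]
        fun i : ℕ => Real.log (selfBase i) ^ 3 := by
      refine (isBigO_codeBound_one.comp_tendsto tendsto_selfBase_sq).trans
        (IsBigO.of_bound 8 (Eventually.of_forall fun i => le_of_eq ?_))
      simp only [Function.comp_apply, Nat.cast_pow, Real.log_pow, norm_pow, norm_mul]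
      norm_num
      ring
    have h2 : (fun i : ℕ => Real.log (selfBase i) ^ 2) =O[atTop] fun i : ℕ => Real.log i := by
      refine IsBigO.trans (g := fun i : ℕ => (selfBase i : ℝ)) ?_ ?_
      · exact (Real.isLittleO_pow_log_id_atTop (n := 2)).isBigO.comp_tendsto
          (tendsto_natCast_atTop_atTop.comp tendsto_selfBase_atTop)
      · refine IsBigO.of_bound 1 ?_
        filter_upwards [eventually_selfBase_le_log] with i hi
        rwa [one_mul, Real.norm_of_nonneg (Nat.cast_nonneg _),
          Real.norm_of_nonneg (Real.log_natCast_nonneg _)]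
    refine (((isBigO_refl (fun i : ℕ => (selfBase i : ℝ)) atTop).mul h1).congr_right
      fun i => ?_).trans (isBigO_selfBase_mul_log.mul h2)
    ring
  | succ e ih =>
    refine isBigO_codeBound_succ (tendsto_log_mul_iterLog (e + 2)) ?_
    have htop : Tendsto (fun i => (selfBase i : ℝ)) atTop atTop :=
      tendsto_natCast_atTop_atTop.comp tendsto_selfBase_atTop
    have h1 : (fun i : ℕ => (codeBound (e + 2) (selfBase i ^ 2) : ℝ)) =O[atTop]
        fun i : ℕ => Real.log (selfBase i) * Real.log^[e + 2] i := by
      refine (ih.comp_tendsto tendsto_selfBase_sq).trans (IsBigO.mul ?_ ?_)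
      · refine IsBigO.of_bound 2 (Eventually.of_forall fun i => le_of_eq ?_)
        simp only [Nat.cast_pow, Real.log_pow, norm_mul]
        norm_num
      · refine IsBigO.of_bound 2 ?_
        filter_upwards [htop.eventually (eventually_iterLog_sq_le e),
          htop.eventually (eventually_iterLog_mono (e + 1)), eventually_selfBase_le_log,
          ((tendsto_iterLog_atTop (e + 1)).comp (tendsto_natCast_atTop_atTop.comp
            tendsto_selfBase_sq)).eventually_ge_atTop 0] with i h1 h2 h3 h4
        have h5 := h2 _ h3
        rw [← Function.iterate_succ_apply] at h5
        simp only [Function.comp_apply] at h4 ⊢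
        rw [Real.norm_of_nonneg h4]
        rw [Nat.cast_pow]
        exact h1.trans ((mul_le_mul_of_nonneg_left h5 zero_le_two).trans
          (mul_le_mul_of_nonneg_left (le_abs_self _) zero_le_two))
    refine (((isBigO_refl (fun i : ℕ => (selfBase i : ℝ)) atTop).mul h1).congr_right
      fun i => ?_).trans (isBigO_selfBase_mul_log.mul (isBigO_refl _ _))
    ring

theorem isBigO_codeBound_log_sq (e : ℕ) :
    (fun i : ℕ => (codeBound (e + 2) i : ℝ)) =O[atTop] fun i : ℕ => Real.log i ^ 2 := by
  refine (isBigO_codeBound e).trans (IsBigO.of_bound 1 ?_)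
  filter_upwards [tendsto_natCast_atTop_atTop.eventually (eventually_iterLog_le_log e),
    ((tendsto_iterLog_atTop (e + 1)).comp tendsto_natCast_atTop_atTop).eventually_ge_atTop 0]
    with i h1 h2
  have h3 := Real.log_natCast_nonneg i
  simp only [Function.comp_apply] at h2
  rw [one_mul, Real.norm_of_nonneg (mul_nonneg h3 h2), Real.norm_of_nonneg (sq_nonneg _), pow_two]
  exact mul_le_mul_of_nonneg_left h1 h3

theorem isLittleO_codeBound (e : ℕ) :
    (fun i : ℕ => (codeBound (e + 2) i : ℝ)) =o[atTop] fun i : ℕ => (i : ℝ) :=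
  (isBigO_codeBound_log_sq e).trans_isLittleO
    ((Real.isLittleO_pow_log_id_atTop (n := 2)).comp_tendsto tendsto_natCast_atTop_atTop)

/-! ### The threshold -/

theorem isBigO_div_mul {g h h' : ℕ → ℝ} (hg : ∀ᶠ n in atTop, 0 < g n) (K : ℝ)
    (hh : h =O[atTop] g) (hh' : ∀ᶠ n : ℕ in atTop, ‖h' n‖ ≤ K * n / g n) :
    (fun n => h' n * h n) =O[atTop] fun n : ℕ => (n : ℝ) := by
  have h1 : h' =O[atTop] fun n : ℕ => (n : ℝ) / g n := by
    refine IsBigO.of_bound K ?_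
    filter_upwards [hh', hg] with n _ h2
    rwa [Real.norm_of_nonneg (div_nonneg (Nat.cast_nonneg n) h2.le), ← mul_div_assoc]
  refine (h1.mul hh).congr' EventuallyEq.rfl ?_
  filter_upwards [hg] with n hn
  exact div_mul_cancel₀ _ hn.ne'

/-- For `d = 2` the factor `log² n` is absorbed by `n ^ (1 / (2c + 1))`, and for `d = 3` it cancels.
For `d > 3`, `g_d (log n) ≥ log n * log^(d-2) n`, which exceeds the order `log n * log^(d-1) n` of
the codes. -/
theorem isBigO_threshold_mul_codeBound (c e : ℕ) :
    (fun n : ℕ => threshold c (e + 2) n * codeBound (e + 2) n) =O[atTop]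
      fun n : ℕ => (n : ℝ) := by
  have hlog : Tendsto (fun n : ℕ => Real.log n) atTop atTop :=
    Real.tendsto_log_atTop.comp tendsto_natCast_atTop_atTop
  rcases e with - | - | e
  · have h1 : (fun n : ℕ => Real.log n ^ 2) =O[atTop]
        fun n : ℕ => (n : ℝ) ^ ((1 : ℝ) / (2 * c + 1)) := by
      have := (isLittleO_log_rpow_rpow_atTop 2
        (show (0 : ℝ) < 1 / (2 * c + 1) by positivity)).isBigO.comp_tendsto
        (tendsto_natCast_atTop_atTop (R := ℝ))
      refine this.congr_left fun n => ?_
      simp only [Function.comp_apply]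
      exact_mod_cast Real.rpow_natCast (Real.log n) 2
    refine ((((isBigO_refl (fun n : ℕ => threshold c 2 n) atTop).mul
      ((isBigO_codeBound_log_sq 0).trans h1)))).trans
      (IsBigO.of_bound ((c : ℝ) ^ ((2 : ℝ) / (2 * c + 1))) ?_)
    filter_upwards [eventually_gt_atTop 0] with n hn
    have hn' : (0 : ℝ) < n := Nat.cast_pos.2 hn
    have hc : (0 : ℝ) < 2 * c + 1 := by positivity
    refine le_of_eq ?_
    simp only [threshold]
    rw [Real.norm_of_nonneg (by positivity), Real.norm_of_nonneg hn'.le,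
      Real.mul_rpow (Nat.cast_nonneg _) (by positivity), ← Real.rpow_natCast,
      ← Real.rpow_mul hn'.le, mul_assoc, ← Real.rpow_add hn']
    have : (c : ℝ) * (2 / (2 * c + 1)) + 1 / (2 * c + 1) = 1 := by
      field_simp
    rw [this, Real.rpow_one]
  · refine isBigO_div_mul (g := fun n => Real.log n ^ 2) ?_ 36 (isBigO_codeBound_log_sq 1) ?_
    · filter_upwards [hlog.eventually_gt_atTop 0] with n hn using pow_pos hn 2
    · refine Eventually.of_forall fun n => le_of_eq ?_
      change ‖36 * (n : ℝ) / Real.log n ^ 2‖ = _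
      exact Real.norm_of_nonneg (by positivity)
  · have hpos : ∀ᶠ n : ℕ in atTop, 0 < Real.log n * Real.log^[e + 2] n :=
      (tendsto_log_mul_iterLog (e + 2)).eventually_gt_atTop 0
    refine isBigO_div_mul (g := fun n => Real.log n * Real.log^[e + 2] n) hpos 4
      ((isBigO_codeBound (e + 2)).trans (IsBigO.mul (isBigO_refl _ _) (IsBigO.of_bound 1 ?_))) ?_
    · filter_upwards [tendsto_natCast_atTop_atTop.eventually (eventually_iterLog_succ_le (e + 2)),
        ((tendsto_iterLog_atTop (e + 3)).comp tendsto_natCast_atTop_atTop).eventually_ge_atTop 0]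
        with n h1 h2
      simp only [Function.comp_apply] at h2
      rw [one_mul, Real.norm_of_nonneg h2]
      exact h1.trans (le_abs_self _)
    · filter_upwards [hlog.eventually (eventually_mul_iterLog_le_invDivIterLog e), hpos]
        with n h1 h2
      rw [← Function.iterate_succ_apply] at h1
      change ‖4 * (n : ℝ) / invDivIterLog (e + 4) (Real.log n)‖ ≤ _
      rw [Real.norm_of_nonneg (div_nonneg (by positivity) (h2.le.trans h1))]
      exact div_le_div_of_nonneg_left (by positivity) h2 h1

/-- Dividing by a large `C` makes the spine fit into `n` nodes. For `d = 1` the function is bounded,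
and `C` is chosen so that `f n / C = 0`. -/
theorem exists_eventually_codeBound_le (c d : ℕ) (hd : 1 ≤ d) (f : ℕ → ℕ)
    (hf : (fun n : ℕ => (f n : ℝ)) =O[atTop] fun n : ℕ => threshold c d n) :
    ∃ C, 1 ≤ C ∧ ∀ᶠ n in atTop,
      (f n / C + 3) * (codeBound d (f n / C + 2) + 3) + 1 ≤ n := by
  obtain ⟨d, rfl⟩ := Nat.exists_eq_add_of_le' hd
  rcases d with - | d
  · obtain ⟨K, hK⟩ := hf.bound
    obtain ⟨C, hC⟩ := exists_nat_gt (K * ‖(c : ℝ) ^ 2 / 9‖)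
    refine ⟨C + 1, Nat.succ_pos _, ?_⟩
    filter_upwards [hK, eventually_ge_atTop (3 * (codeBound 1 2 + 3) + 1)] with n h1 h2
    have h3 : f n < C + 1 := by
      have : (f n : ℝ) < C := by
        rw [Real.norm_of_nonneg (Nat.cast_nonneg _)] at h1
        exact h1.trans_lt hC
      exact (Nat.cast_lt.1 this).trans (Nat.lt_succ_self _)
    rwa [Nat.div_eq_of_lt h3]
  · have h1 : (fun n : ℕ => (f n : ℝ) * codeBound (d + 2) n) =O[atTop] fun n : ℕ => (n : ℝ) :=
      (hf.mul (isBigO_refl _ _)).trans (isBigO_threshold_mul_codeBound c d)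
    obtain ⟨K, hK⟩ := h1.bound
    obtain ⟨k, hk⟩ := exists_nat_gt K
    -- With `x = f n / C` and `B = codeBound (d + 2) n`, the four terms `x * B`, `3 * x`, `3 * B`
    -- and `10` are at most `n / 16`, `3 * n / 16`, `n / 4` and `n / 4`.
    refine ⟨16 * (k + 1), by omega, ?_⟩
    filter_upwards [hK, (isLittleO_codeBound d).bound (show (0 : ℝ) < 1 / 12 by norm_num),
      eventually_ge_atTop 40] with n h2 h3 hn
    have hB : 12 * codeBound (d + 2) n ≤ n := by
      rw [Real.norm_of_nonneg (Nat.cast_nonneg _), Real.norm_of_nonneg (Nat.cast_nonneg _)] at h3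
      have : (12 : ℝ) * codeBound (d + 2) n ≤ n := by linarith
      exact_mod_cast this
    have hfB : f n * codeBound (d + 2) n ≤ (k + 1) * n := by
      rw [Real.norm_of_nonneg (by positivity), Real.norm_of_nonneg (Nat.cast_nonneg _)] at h2
      have : (f n : ℝ) * codeBound (d + 2) n ≤ (k + 1) * n :=
        h2.trans (mul_le_mul_of_nonneg_right (by linarith) (Nat.cast_nonneg _))
      exact_mod_cast this
    have hpos : 1 ≤ codeBound (d + 2) n := Nat.le_add_right 1 _
    have hle : 16 * (f n / (16 * (k + 1)) * codeBound (d + 2) n) ≤ n := by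
      refine Nat.le_of_mul_le_mul_left ?_ (Nat.succ_pos k)
      calc (k + 1) * (16 * (f n / (16 * (k + 1)) * codeBound (d + 2) n))
          = (16 * (k + 1)) * (f n / (16 * (k + 1))) * codeBound (d + 2) n := by ring
        _ ≤ f n * codeBound (d + 2) n := Nat.mul_le_mul_right _ (Nat.mul_div_le _ _)
        _ ≤ (k + 1) * n := hfB
    generalize f n / (16 * (k + 1)) = x at hle
    have hx : x ≤ x * codeBound (d + 2) n := Nat.le_mul_of_pos_right x hpos
    have hmono : codeBound (d + 2) (x + 2) ≤ codeBound (d + 2) n :=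
      codeBound_mono _ (by omega)
    calc (x + 3) * (codeBound (d + 2) (x + 2) + 3) + 1
        ≤ (x + 3) * (codeBound (d + 2) n + 3) + 1 := by gcongr
      _ = x * codeBound (d + 2) n + 3 * x + 3 * codeBound (d + 2) n + 10 := by ring
      _ ≤ n := by omega

end Caterpillar

/-! ### Choice of the spine length for a given complexity -/

open Caterpillar in
theorem corollary1 (c d : ℕ) (hc : 1 ≤ c) (hd : 1 ≤ d) (f : ℕ → ℕ)
    (hf : (fun n : ℕ => (f n : ℝ)) =O[atTop] fun n : ℕ => threshold c d n) :
    ∃ (L : LocalChecker (Fin c) (d + 4)) (P : GeneralizedLCL c (d + 4)),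
      (∀ (V : Type) [Fintype V] (G : SimpleGraph V) (col : V → Fin c), G.IsTree →
        (L.Accepts G col ↔ ∃ out : V → P.Out, P.IsSolution G col out)) ∧
      ∀ κ : ℕ, 1 ≤ κ → ∃ t : ℕ → ℕ, P.HasComplexity κ t ∧
        (fun n : ℕ => (t n : ℝ)) =Θ[atTop] fun n : ℕ => (f n : ℝ) := by
  obtain ⟨C, hC, hev⟩ := exists_eventually_codeBound_le c d hd f hf
  obtain ⟨L, P, hLP, hP⟩ := exists_hasComplexity c d hc
    -- Sizes with `f n = 0` are excluded since the complexity must vanish there.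
    (fun n => 1 ≤ f n ∧ (f n / C + 3) * (codeBound d (f n / C + 2) + 3) + 1 ≤ n)
    (fun n => f n / C) fun n hn => hn.2
  refine ⟨L, P, hLP, fun κ hκ => ?_⟩
  obtain ⟨t, ht, htS, ht0⟩ := hP κ hκ
  -- As `f n ≥ 1`, `2 * (f n / C) + 3 * d + 11 ≤ (3 * d + 13) * f n`; conversely `f n ≤ C * (f n / C
  -- + 1)`.
  refine ⟨t, ht, IsBigO.of_bound (3 * d + 13 : ℕ) ?_, IsBigO.of_bound C ?_⟩
  · filter_upwards [hev] with n hn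
    rw [Real.norm_of_nonneg (Nat.cast_nonneg _), Real.norm_of_nonneg (Nat.cast_nonneg _)]
    norm_cast
    by_cases hfn : 1 ≤ f n
    · have h1 := (htS n ⟨hfn, hn⟩).2
      have h2 : f n / C ≤ f n := Nat.div_le_self _ _
      nlinarith
    · rw [ht0 n fun h => hfn h.1]
      exact Nat.zero_le _
  · filter_upwards [hev] with n hn
    rw [Real.norm_of_nonneg (Nat.cast_nonneg _), Real.norm_of_nonneg (Nat.cast_nonneg _)]
    norm_cast
    by_cases hfn : 1 ≤ f n
    · have h1 := (htS n ⟨hfn, hn⟩).1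
      exact (Nat.lt_mul_div_succ (f n) hC).le.trans (Nat.mul_le_mul_left C (by omega))
    · omega
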